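/- Let $\mathfrak L$ be a set (a finite or infinite lattice). For $J\in\{\tfrac12,1,\tfrac32,\dots\}$ let $\mathfrak A_J$ be the quasi-local $C^*$-algebra of a system of spin-$J$ degrees of freedom at the sites of $\mathfrak L$ (the norm closure of the union over finite $\Lambda\subset\mathfrak L$ of $\bigotimes_{x\in\Lambda}\mathbb M_{2J+1}(\mathbb C)$), with spin operators $S_x=(S^1_x,S^2_x,S^3_x)$ and standard basis $S^3_x|m\rangle=m|m\rangle$ at each site. Fix angles $\theta_x\in[0,\pi]$, $\phi_x\in[0,2\pi]$ $(x\in\mathfrak L)$, let $$|(\theta_x,\phi_x)\rangle=\sum_{m=-J}^{J}\binom{2J}{J-m}^{1/2}(\cos\tfrac12\theta_x)^{J+m}(\sin\tfrac12\theta_x)^{J-m}e^{i(J-m)\phi_x}\,|m\rangle ,$$ and let $\omega=\bigotimes_{x\in\mathfrak L}\langle(\theta_x,\phi_x)|\cdot|(\theta_x,\phi_x)\rangle$ be the product coherent state on $\mathfrak A_J$. Let $\ell^1_3(\mathfrak L)$ be the space of families $v=(v_x)_{x\in\mathfrak L}$ in $\mathbb R^3$ with $|v|_1=\sum_x|v_x|<\infty$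 (Euclidean length), and for $v\in\ell^1_3(\mathfrak L)$ put $$F_J(v)=\sqrt{\tfrac2J}\,\sum_{x\in\mathfrak L}\bigl[v_x\cdot S_x-\omega(v_x\cdot S_x)\bigr]\in\mathfrak A_J ,$$ a norm-convergent sum. Let $f^1_x=(\cos\theta_x\cos\phi_x,\cos\theta_x\sin\phi_x,-\sin\theta_x)$, $f^2_x=(-\sin\phi_x,\cos\phi_x,0)$, and let $\tilde v\in\ell^2(\mathfrak L)$ be the complex family $\tilde v_x=f^1_x\cdot v_x+i\,f^2_x\cdot v_x$. On the bosonic Fock space over $\ell^2(\mathfrak L)$, with vacuum $\tilde\Omega$ and creation and annihilation operators $a^*_x,a_x$, $[a_x,a^*_y]=\delta_{xy}$, let $$F(\tilde v)=\sum_{x\in\mathfrak L}\bigl[\tilde v_x\,a^*_x+\overline{\tilde v_x}\,a_x\bigr]$$ be the boson field operator, acting on the invariant domain of vectors with a bounded number of particles, and let $\tilde\omega(T)=\langle\tilde\Omega,T\tilde\Omega\rangle$ be the Fock state. Then for all $k\in\mathbb N$ and $v_1,\dots,v_k\in\ell^1_3(\mathfrak L)$ (products in the order $j=1,\dots,k$)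 $$\lim_{J\to\infty}\omega\Bigl(\prod_{j=1}^kF_J(v_j)\Bigr)=\tilde\omega\Bigl(\prod_{j=1}^kF(\tilde v_j)\Bigr),$$ the limit being taken along half-integers $J$. More precisely, for all $J\in\{\tfrac12,1,\tfrac32,\dots\}$, $$\Bigl|\omega\Bigl(\prod_{j=1}^kF_J(v_j)\Bigr)-\tilde\omega\Bigl(\prod_{j=1}^kF(\tilde v_j)\Bigr)\Bigr|\le\frac{(k!)^{1/2}}{(2J)^{1/2}}\Bigl[\prod_{j=1}^k|v_j|_1\Bigr]\sum_{i=1}^k2^{k+i}(k-i)^{1/2}.$$ -/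

import Mathlib

open Filter Topology
open scoped InnerProductSpace ENNReal

noncomputable section

namespace SpinFluctuations

section SpinSystem

variable {L : Type*} [DecidableEq L]

/-! ### The spin system -/

/-- The Hilbert space `ℓ²(L → {0, …, N})` of all spin configurations, `N = 2J`. The value `a` at a
site stands for the standard basis vector `|m⟩` of `ℂ^{2J+1}` with `m = J - a`. It carries a
faithful representation of all local observables. -/
abbrev ConfigSpace (L : Type*) (N : ℕ) : Type _ := lp (fun _ : L → Fin (N + 1) => ℂ) 2

theorem sum_update_le {N : ℕ} (x : L) (ψ : ConfigSpace L N) (m : Fin (N + 1))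
    (s : Finset (L → Fin (N + 1))) :
    ∑ σ ∈ s, ‖ψ (Function.update σ x m)‖ ^ 2 ≤ (N + 1) * ‖ψ‖ ^ 2 := by
  classical
  rw [← Finset.sum_fiberwise s (fun σ => σ x)]
  calc _ ≤ ∑ _a : Fin (N + 1), ‖ψ‖ ^ 2 := by
        refine Finset.sum_le_sum fun a _ => ?_
        have hinj : Set.InjOn (fun σ : L → Fin (N + 1) => Function.update σ x m)
            (s.filter fun σ => σ x = a) := by
          intro σ hσ τ hτ h
          simp only [Finset.coe_filter, Set.mem_ofPred_eq] at hσ hτ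
          funext y
          by_cases hy : y = x
          · subst hy; rw [hσ.2, hτ.2]
          · simpa [hy] using congrFun h y
        rw [← Finset.sum_image (f := fun σ => ‖ψ σ‖ ^ 2) hinj]
        simpa using lp.sum_rpow_le_norm_rpow (p := 2) (by simp) ψ
          (Finset.image (fun σ : L → Fin (N + 1) => Function.update σ x m)
            (s.filter fun σ => σ x = a))
    _ = (N + 1) * ‖ψ‖ ^ 2 := by simp

/-- The action on coordinates of a one-site matrix `A` placed at the site `x`. -/
def siteFun {N : ℕ} (x : L) (A : Matrix (Fin (N + 1)) (Fin (N + 1)) ℂ)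
    (ψ : (L → Fin (N + 1)) → ℂ) (σ : L → Fin (N + 1)) : ℂ :=
  ∑ m, A (σ x) m * ψ (Function.update σ x m)

theorem sum_siteFun_le {N : ℕ} (x : L) (A : Matrix (Fin (N + 1)) (Fin (N + 1)) ℂ)
    (ψ : ConfigSpace L N) (s : Finset (L → Fin (N + 1))) :
    ∑ σ ∈ s, ‖siteFun x A ψ σ‖ ^ 2 ≤
      (√(∑ a, ∑ m, ‖A a m‖ ^ 2) * (N + 1) * ‖ψ‖) ^ 2 := by
  set F : ℝ := ∑ a, ∑ m, ‖A a m‖ ^ 2 with hF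
  have hF0 : 0 ≤ F := by positivity
  calc _ ≤ ∑ σ ∈ s, F * ∑ m, ‖ψ (Function.update σ x m)‖ ^ 2 := by
        refine Finset.sum_le_sum fun σ _ => ?_
        have h1 : ‖siteFun x A ψ σ‖ ≤ ∑ m, ‖A (σ x) m‖ * ‖ψ (Function.update σ x m)‖ := by
          refine (norm_sum_le _ _).trans (le_of_eq ?_)
          simp
        calc _ ≤ (∑ m, ‖A (σ x) m‖ * ‖ψ (Function.update σ x m)‖) ^ 2 := by gcongr
          _ ≤ (∑ m, ‖A (σ x) m‖ ^ 2) * ∑ m, ‖ψ (Function.update σ x m)‖ ^ 2 :=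
            Finset.sum_mul_sq_le_sq_mul_sq _ _ _
          _ ≤ _ := by
            gcongr
            exact Finset.single_le_sum (f := fun a => ∑ m, ‖A a m‖ ^ 2)
              (fun a _ => by positivity) (Finset.mem_univ (σ x))
    _ = F * ∑ m, ∑ σ ∈ s, ‖ψ (Function.update σ x m)‖ ^ 2 := by
        rw [← Finset.mul_sum, Finset.sum_comm]
    _ ≤ F * ∑ _m : Fin (N + 1), (N + 1) * ‖ψ‖ ^ 2 := by
        gcongr with m; exact sum_update_le x ψ m s
    _ = _ := by
        rw [mul_pow, mul_pow, Real.sq_sqrt hF0]; simp; ring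

/-- The one-site observable `A_x = ⋯ ⊗ 1 ⊗ A ⊗ 1 ⊗ ⋯` with the matrix `A` at the site `x`. -/
def siteOp {N : ℕ} (x : L) (A : Matrix (Fin (N + 1)) (Fin (N + 1)) ℂ) :
    ConfigSpace L N →L[ℂ] ConfigSpace L N :=
  LinearMap.mkContinuous
    { toFun := fun ψ => ⟨siteFun x A ψ,
        memℓp_gen' (C := (√(∑ a, ∑ m, ‖A a m‖ ^ 2) * (N + 1) * ‖ψ‖) ^ 2)
          (fun s => by simpa using sum_siteFun_le x A ψ s)⟩
      map_add' := fun ψ χ => by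
        refine lp.ext (funext fun σ => ?_)
        simp [siteFun, mul_add, Finset.sum_add_distrib]
        rfl
      map_smul' := fun c ψ => by
        refine lp.ext (funext fun σ => ?_)
        simp [siteFun, Finset.mul_sum, mul_left_comm] }
    (√(∑ a, ∑ m, ‖A a m‖ ^ 2) * (N + 1))
    (fun ψ => lp.norm_le_of_forall_sum_le (by simp) (by positivity)
      (fun s => by simpa using sum_siteFun_le x A ψ s))

theorem siteOp_apply {N : ℕ} (x : L) (A : Matrix (Fin (N + 1)) (Fin (N + 1)) ℂ)
    (ψ : ConfigSpace L N) (σ : L → Fin (N + 1)) :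
    siteOp x A ψ σ = ∑ m, A (σ x) m * ψ (Function.update σ x m) := rfl

theorem norm_siteOp_le {N : ℕ} (x : L) (A : Matrix (Fin (N + 1)) (Fin (N + 1)) ℂ) :
    ‖siteOp x A‖ ≤ √(∑ a, ∑ m, ‖A a m‖ ^ 2) * (N + 1) :=
  LinearMap.mkContinuous_norm_le _ (by positivity) _

theorem siteOp_mul {N : ℕ} (x : L) (A B : Matrix (Fin (N + 1)) (Fin (N + 1)) ℂ) :
    siteOp x (A * B) = siteOp x A * siteOp x B := by
  ext ψ σ
  simp only [mul_apply_eq_comp, siteOp_apply, Matrix.mul_apply, Function.update_self,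
    Function.update_idem, Finset.mul_sum, Finset.sum_mul]
  rw [Finset.sum_comm]
  simp [mul_assoc]

theorem siteOp_commute {N : ℕ} {x y : L} (h : x ≠ y)
    (A B : Matrix (Fin (N + 1)) (Fin (N + 1)) ℂ) : Commute (siteOp x A) (siteOp y B) := by
  ext ψ σ
  simp only [mul_apply_eq_comp, siteOp_apply, Finset.mul_sum]
  rw [Finset.sum_comm]
  refine Finset.sum_congr rfl fun m _ => Finset.sum_congr rfl fun n _ => ?_
  rw [Function.update_of_ne h.symm, Function.update_of_ne h, Function.update_comm h]
  ring

theorem siteOp_star {N : ℕ} (x : L) (A : Matrix (Fin (N + 1)) (Fin (N + 1)) ℂ) :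
    star (siteOp x A) = siteOp x A.conjTranspose := by
  rw [ContinuousLinearMap.star_eq_adjoint, eq_comm, ContinuousLinearMap.eq_adjoint_iff]
  intro φ ψ
  let e : (L → Fin (N + 1)) ≃ ({j // j ≠ x} → Fin (N + 1)) × Fin (N + 1) :=
    (Equiv.funSplitAt x (Fin (N + 1))).trans (Equiv.prodComm _ _)
  have he : ∀ τ a, (e.symm (τ, a)) x = a := fun τ a => by simp [e, Equiv.funSplitAt]
  have hu : ∀ τ a m, Function.update (e.symm (τ, a)) x m = e.symm (τ, m) := fun τ a m => by
    funext y
    by_cases hy : y = x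
    · subst hy; simp [e, Equiv.funSplitAt]
    · simp [e, Equiv.funSplitAt, hy]
  have key : ∀ f g : ConfigSpace L N,
      ⟪f, g⟫_ℂ = ∑' τ, ∑ a, ⟪f (e.symm (τ, a)), g (e.symm (τ, a))⟫_ℂ := by
    intro f g
    rw [lp.inner_eq_tsum, ← e.symm.tsum_eq, Summable.tsum_prod]
    · simp [tsum_fintype]
    · exact (e.symm.summable_iff (f := fun i => ⟪f i, g i⟫_ℂ)).2 (lp.summable_inner f g)
  rw [key, key]
  refine tsum_congr fun τ => ?_
  simp only [siteOp_apply, he, hu, RCLike.inner_apply, map_sum, map_mul, Finset.mul_sum,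
    Finset.sum_mul, Matrix.conjTranspose_apply]
  rw [Finset.sum_comm]
  refine Finset.sum_congr rfl fun m _ => Finset.sum_congr rfl fun n _ => ?_
  simp
  ring

/-- The algebra of local observables: the `*`-algebra generated by all one-site matrices. -/
def localAlgebra (L : Type*) [DecidableEq L] (N : ℕ) :
    StarSubalgebra ℂ (ConfigSpace L N →L[ℂ] ConfigSpace L N) :=
  StarAlgebra.adjoin ℂ {T | ∃ x A, T = siteOp x A}

/-- The quasi-local algebra `𝔄_J`, `N = 2J`: the norm closure of the algebra of local observables. -/
def quasiLocalAlgebra (L : Type*) [DecidableEq L] (N : ℕ) :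
    StarSubalgebra ℂ (ConfigSpace L N →L[ℂ] ConfigSpace L N) :=
  (localAlgebra L N).topologicalClosure

theorem siteOp_mem {N : ℕ} (x : L) (A : Matrix (Fin (N + 1)) (Fin (N + 1)) ℂ) :
    siteOp x A ∈ quasiLocalAlgebra L N :=
  StarSubalgebra.le_topologicalClosure _ (StarAlgebra.subset_adjoin _ _ ⟨x, A, rfl⟩)

/-- The one-site observable `A_x` as an element of the quasi-local algebra. -/
def siteObs {N : ℕ} (x : L) (A : Matrix (Fin (N + 1)) (Fin (N + 1)) ℂ) : quasiLocalAlgebra L N :=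
  ⟨siteOp x A, siteOp_mem x A⟩

instance (L : Type*) [DecidableEq L] (N : ℕ) : CompleteSpace (quasiLocalAlgebra L N) :=
  inferInstanceAs (CompleteSpace (localAlgebra L N).topologicalClosure)

/-- Observables localized near finitely many sites commute with one-site observables elsewhere. -/
theorem exists_commute {N : ℕ} {T : ConfigSpace L N →L[ℂ] ConfigSpace L N}
    (hT : T ∈ localAlgebra L N) :
    ∃ Λ : Finset L, ∀ y ∉ Λ, ∀ B : Matrix (Fin (N + 1)) (Fin (N + 1)) ℂ,
      Commute T (siteOp y B) := by
  induction hT using StarAlgebra.adjoin_induction with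
  | mem T h =>
    obtain ⟨x, A, rfl⟩ := h
    exact ⟨{x}, fun y hy B => siteOp_commute (by simpa [eq_comm] using hy) A B⟩
  | algebraMap r => exact ⟨∅, fun y _ B => Algebra.commutes r _⟩
  | add S T _ _ hS hT =>
    obtain ⟨Λ₁, h₁⟩ := hS
    obtain ⟨Λ₂, h₂⟩ := hT
    refine ⟨Λ₁ ∪ Λ₂, fun y hy B => ?_⟩
    simp only [Finset.mem_union, not_or] at hy
    exact (h₁ y hy.1 B).add_left (h₂ y hy.2 B)
  | mul S T _ _ hS hT =>
    obtain ⟨Λ₁, h₁⟩ := hS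
    obtain ⟨Λ₂, h₂⟩ := hT
    refine ⟨Λ₁ ∪ Λ₂, fun y hy B => ?_⟩
    simp only [Finset.mem_union, not_or] at hy
    exact (h₁ y hy.1 B).mul_left (h₂ y hy.2 B)
  | star T _ hT =>
    obtain ⟨Λ, h⟩ := hT
    refine ⟨Λ, fun y hy B => ?_⟩
    have := (h y hy B.conjTranspose).star_star
    rwa [siteOp_star, Matrix.conjTranspose_conjTranspose] at this

/-! ### Coherent states -/

/-- The coherent vector `|(θ, φ)⟩ ∈ ℂ^{2J+1}`, `N = 2J`, in the standard basis; the index `a`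
stands for `m = J - a`. -/
def coherentVector (N : ℕ) (θ φ : ℝ) (a : Fin (N + 1)) : ℂ :=
  (√(N.choose a) * Real.cos (θ / 2) ^ (N - (a : ℕ)) * Real.sin (θ / 2) ^ (a : ℕ) : ℝ) *
    Complex.exp (Complex.I * (a : ℕ) * φ)

theorem norm_sq_coherentVector (N : ℕ) (θ φ : ℝ) : ∑ a, ‖coherentVector N θ φ a‖ ^ 2 = 1 := by
  have h : ∀ a : Fin (N + 1), ‖coherentVector N θ φ a‖ ^ 2 =
      (Real.sin (θ / 2) ^ 2) ^ (a : ℕ) * (Real.cos (θ / 2) ^ 2) ^ (N - (a : ℕ)) *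
        (N.choose a : ℝ) := by
    intro a
    have he : ‖Complex.exp (Complex.I * (a : ℕ) * φ)‖ = 1 := by
      have : Complex.I * (a : ℕ) * φ = ((a : ℕ) * φ : ℝ) * Complex.I := by push_cast; ring
      rw [this, Complex.norm_exp_ofReal_mul_I]
    rw [coherentVector, norm_mul, he, mul_one, Complex.norm_real, Real.norm_eq_abs, sq_abs,
      mul_pow, mul_pow, Real.sq_sqrt (by positivity)]
    ring
  simp_rw [h]
  rw [Fin.sum_univ_eq_sum_range (fun a => (Real.sin (θ / 2) ^ 2) ^ a *
    (Real.cos (θ / 2) ^ 2) ^ (N - a) * (N.choose a : ℝ)), ← add_pow, Real.sin_sq_add_cos_sq, one_pow]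

open Classical in
/-- The product vector with `|(θ_x, φ_x)⟩` at the sites `x ∈ Λ` and the fixed basis vector `|J⟩`
at all other sites. -/
def productVector (N : ℕ) (θ φ : L → ℝ) (Λ : Finset L) : ConfigSpace L N :=
  ⟨fun σ => if ∀ y ∉ Λ, σ y = 0 then ∏ x ∈ Λ, coherentVector N (θ x) (φ x) (σ x) else 0, by
    refine Memℓp.of_exponent_ge (memℓp_zero ?_) (zero_le (a := 2))
    refine Set.Finite.of_finite_image (f := fun σ (x : Λ) => σ x) (Set.toFinite _) ?_
    intro σ hσ τ hτ h
    simp only [ne_eq, ite_eq_right_iff, Set.mem_ofPred_eq, Classical.not_imp] at hσ hτ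
    funext y
    by_cases hy : y ∈ Λ
    · exact congrFun h ⟨y, hy⟩
    · rw [hσ.1 y hy, hτ.1 y hy]⟩

open Classical in
theorem productVector_apply (N : ℕ) (θ φ : L → ℝ) (Λ : Finset L) (σ : L → Fin (N + 1)) :
    productVector N θ φ Λ σ =
      if ∀ y ∉ Λ, σ y = 0 then ∏ x ∈ Λ, coherentVector N (θ x) (φ x) (σ x) else 0 := rfl

/-- The operator `|(θ_y, φ_y)⟩⟨J|` at a single site. -/
def raiseMatrix (N : ℕ) (θ φ : ℝ) : Matrix (Fin (N + 1)) (Fin (N + 1)) ℂ :=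
  Matrix.of fun a m => if m = 0 then coherentVector N θ φ a else 0

theorem siteOp_raise (N : ℕ) (θ φ : L → ℝ) (Λ : Finset L) {y : L} (hy : y ∉ Λ) :
    siteOp y (raiseMatrix N (θ y) (φ y)) (productVector N θ φ Λ) =
      productVector N θ φ (insert y Λ) := by
  refine lp.ext (funext fun σ => ?_)
  rw [siteOp_apply]
  simp only [raiseMatrix, Matrix.of_apply, ite_mul, zero_mul, Finset.sum_ite_eq',
    Finset.mem_univ, if_true, productVector_apply, Finset.prod_insert hy]
  have h1 : (∀ z ∉ Λ, Function.update σ y 0 z = 0) ↔ (∀ z ∉ insert y Λ, σ z = 0) := by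
    refine forall_congr' fun z => ?_
    by_cases hz : z = y
    · subst hz; simp
    · simp [hz]
  have h2 : ∏ x ∈ Λ, coherentVector N (θ x) (φ x) (Function.update σ y 0 x) =
      ∏ x ∈ Λ, coherentVector N (θ x) (φ x) (σ x) :=
    Finset.prod_congr rfl fun x hx => by
      rw [Function.update_of_ne (ne_of_mem_of_not_mem hx hy)]
  simp only [h2, mul_ite, mul_zero]
  by_cases hc : ∀ z ∉ insert y Λ, σ z = 0
  · rw [if_pos hc, if_pos (h1.2 hc)]
  · rw [if_neg hc, if_neg (fun h => hc (h1.1 h))]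

/-- `⟨Ω, A Ω⟩` for the coherent vector `Ω = |(θ, φ)⟩` and a one-site matrix `A`. -/
def siteExpectation (N : ℕ) (θ φ : ℝ) (A : Matrix (Fin (N + 1)) (Fin (N + 1)) ℂ) : ℂ :=
  star (coherentVector N θ φ) ⬝ᵥ A.mulVec (coherentVector N θ φ)

theorem raise_sandwich (N : ℕ) (θ φ : L → ℝ) (Λ : Finset L) {y : L} (hy : y ∉ Λ)
    (A : Matrix (Fin (N + 1)) (Fin (N + 1)) ℂ) :
    siteOp y ((raiseMatrix N (θ y) (φ y)).conjTranspose * (A * raiseMatrix N (θ y) (φ y)))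
      (productVector N θ φ Λ) = siteExpectation N (θ y) (φ y) A • productVector N θ φ Λ := by
  have hM : ∀ a m, ((raiseMatrix N (θ y) (φ y)).conjTranspose *
      (A * raiseMatrix N (θ y) (φ y))) a m =
      if a = 0 then if m = 0 then siteExpectation N (θ y) (φ y) A else 0 else 0 := by
    intro a m
    by_cases ha : a = 0 <;> by_cases hm : m = 0 <;>
      simp [Matrix.mul_apply, raiseMatrix, siteExpectation, dotProduct, Matrix.mulVec, ha, hm]
  refine lp.ext (funext fun σ => ?_)
  rw [siteOp_apply]
  simp only [hM, lp.coeFn_smul, Pi.smul_apply, smul_eq_mul]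
  by_cases h0 : σ y = 0
  · have : Function.update σ y 0 = σ := by rw [← h0, Function.update_eq_self]
    simp [h0, this]
  · have : productVector N θ φ Λ σ = 0 := by
      rw [productVector_apply, if_neg]
      exact fun h => h0 (h y hy)
    simp [h0, this]

theorem inner_productVector_insert (N : ℕ) (θ φ : L → ℝ) (Λ : Finset L) {y : L} (hy : y ∉ Λ)
    (T : ConfigSpace L N →L[ℂ] ConfigSpace L N)
    (hT : ∀ B : Matrix (Fin (N + 1)) (Fin (N + 1)) ℂ, Commute T (siteOp y B))
    (A : Matrix (Fin (N + 1)) (Fin (N + 1)) ℂ) :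
    ⟪productVector N θ φ (insert y Λ), T (siteOp y A (productVector N θ φ (insert y Λ)))⟫_ℂ =
      siteExpectation N (θ y) (φ y) A *
        ⟪productVector N θ φ Λ, T (productVector N θ φ Λ)⟫_ℂ := by
  rw [← siteOp_raise N θ φ Λ hy, ← ContinuousLinearMap.adjoint_inner_right,
    ← ContinuousLinearMap.star_eq_adjoint, siteOp_star]
  have h : ∀ ψ, siteOp y (raiseMatrix N (θ y) (φ y)).conjTranspose (T ψ) =
      T (siteOp y (raiseMatrix N (θ y) (φ y)).conjTranspose ψ) := fun ψ =>
    (congrArg (fun S => S ψ) (hT (raiseMatrix N (θ y) (φ y)).conjTranspose).eq).symm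
  have h2 : siteOp y (raiseMatrix N (θ y) (φ y)).conjTranspose
      (siteOp y A (siteOp y (raiseMatrix N (θ y) (φ y)) (productVector N θ φ Λ))) =
      siteExpectation N (θ y) (φ y) A • productVector N θ φ Λ := by
    rw [← raise_sandwich N θ φ Λ hy, siteOp_mul, siteOp_mul]
    rfl
  rw [h, h2, map_smul, inner_smul_right]

theorem siteExpectation_one (N : ℕ) (θ φ : ℝ) : siteExpectation N θ φ 1 = 1 := by
  have := norm_sq_coherentVector N θ φ
  rw [siteExpectation, Matrix.one_mulVec, dotProduct, ← Complex.ofReal_one, ← this]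
  push_cast
  refine Finset.sum_congr rfl fun a _ => ?_
  rw [Pi.star_apply, RCLike.star_def, mul_comm, Complex.mul_conj, Complex.normSq_eq_norm_sq]
  push_cast; rfl

theorem siteOp_one {N : ℕ} (x : L) : siteOp x (1 : Matrix (Fin (N + 1)) (Fin (N + 1)) ℂ) = 1 := by
  ext ψ σ
  simp [siteOp_apply, Matrix.one_apply]

theorem inner_productVector_of_subset (N : ℕ) (θ φ : L → ℝ) (Λ₀ : Finset L)
    (T : ConfigSpace L N →L[ℂ] ConfigSpace L N)
    (hT : ∀ y ∉ Λ₀, ∀ B : Matrix (Fin (N + 1)) (Fin (N + 1)) ℂ, Commute T (siteOp y B))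
    {Λ : Finset L} (h : Λ₀ ⊆ Λ) :
    ⟪productVector N θ φ Λ, T (productVector N θ φ Λ)⟫_ℂ =
      ⟪productVector N θ φ Λ₀, T (productVector N θ φ Λ₀)⟫_ℂ := by
  have key : ∀ Δ : Finset L, Disjoint Λ₀ Δ →
      ⟪productVector N θ φ (Δ ∪ Λ₀), T (productVector N θ φ (Δ ∪ Λ₀))⟫_ℂ =
      ⟪productVector N θ φ Λ₀, T (productVector N θ φ Λ₀)⟫_ℂ := by
    intro Δ
    induction Δ using Finset.induction_on with
    | empty => simp
    | insert y Δ hy ih =>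
      intro hd
      rw [Finset.disjoint_insert_right] at hd
      have hy' : y ∉ Δ ∪ Λ₀ := by simp [hy, hd.1]
      have := inner_productVector_insert N θ φ (Δ ∪ Λ₀) hy' T (hT y hd.1) 1
      rw [siteOp_one, siteExpectation_one, one_mul, one_apply_eq_self, ih hd.2] at this
      rw [Finset.insert_union, this]
  have := key (Λ \ Λ₀) Finset.disjoint_sdiff
  rwa [Finset.sdiff_union_of_subset h] at this

theorem norm_productVector (N : ℕ) (θ φ : L → ℝ) (Λ : Finset L) :
    ‖productVector N θ φ Λ‖ = 1 := by
  classical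
  have h0 : productVector N θ φ ∅ =
      lp.single (E := fun _ : L → Fin (N + 1) => ℂ) 2 (0 : L → Fin (N + 1)) (1 : ℂ) := by
    refine lp.ext (funext fun σ => ?_)
    rw [productVector_apply, lp.single_apply]
    by_cases h : σ = 0
    · subst h; simp
    · rw [if_neg, Pi.single_eq_of_ne h]
      exact fun h' => h (funext fun y => h' y (by simp))
  have h := inner_productVector_of_subset N θ φ ∅ 1 (fun y _ B => Commute.one_left _)
    (Finset.empty_subset Λ)
  rw [one_apply_eq_self, one_apply_eq_self, h0,
    inner_self_eq_norm_sq_to_K, inner_self_eq_norm_sq_to_K, lp.norm_single (by norm_num)] at h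
  have h2 : ‖productVector N θ φ Λ‖ ^ 2 = 1 := by
    have h3 : ((‖productVector N θ φ Λ‖ ^ 2 : ℝ) : ℂ) = ((1 : ℝ) : ℂ) := by
      simpa using h
    exact_mod_cast h3
  exact (pow_eq_one_iff_of_nonneg (norm_nonneg _) two_ne_zero).1 h2

/-- The expectation of `T` in the product vector over `Λ`. -/
def productExpectation (N : ℕ) (θ φ : L → ℝ) (Λ : Finset L)
    (T : ConfigSpace L N →L[ℂ] ConfigSpace L N) : ℂ :=
  ⟪productVector N θ φ Λ, T (productVector N θ φ Λ)⟫_ℂ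

theorem norm_productExpectation_le (N : ℕ) (θ φ : L → ℝ) (Λ : Finset L)
    (T : ConfigSpace L N →L[ℂ] ConfigSpace L N) : ‖productExpectation N θ φ Λ T‖ ≤ ‖T‖ := by
  refine (norm_inner_le_norm _ _).trans ?_
  rw [norm_productVector, one_mul]
  simpa [norm_productVector] using T.le_opNorm (productVector N θ φ Λ)

theorem tendsto_productExpectation (N : ℕ) (θ φ : L → ℝ) (T : quasiLocalAlgebra L N) :
    Tendsto (fun Λ => productExpectation N θ φ Λ (T : ConfigSpace L N →L[ℂ] ConfigSpace L N)) atTop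
      (𝓝 (limUnder atTop fun Λ =>
        productExpectation N θ φ Λ (T : ConfigSpace L N →L[ℂ] ConfigSpace L N))) := by
  refine CauchySeq.tendsto_limUnder ?_
  rw [Metric.cauchySeq_iff']
  intro ε hε
  have hT : (T : ConfigSpace L N →L[ℂ] ConfigSpace L N) ∈
      closure (localAlgebra L N : Set (ConfigSpace L N →L[ℂ] ConfigSpace L N)) := T.2
  obtain ⟨S, hS, hd⟩ := Metric.mem_closure_iff.1 hT (ε / 2) (by positivity)
  obtain ⟨Λ₀, h⟩ := exists_commute hS
  refine ⟨Λ₀, fun Λ hΛ => ?_⟩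
  have hS' : productExpectation N θ φ Λ S = productExpectation N θ φ Λ₀ S :=
    inner_productVector_of_subset N θ φ Λ₀ S h hΛ
  have hsub : ∀ Λ, productExpectation N θ φ Λ (T : ConfigSpace L N →L[ℂ] ConfigSpace L N) =
      productExpectation N θ φ Λ (T - S) + productExpectation N θ φ Λ S := by
    intro Λ
    simp [productExpectation]
  rw [dist_eq_norm] at hd ⊢
  rw [hsub Λ, hsub Λ₀, hS', add_sub_add_right_eq_sub]
  calc _ ≤ ‖productExpectation N θ φ Λ (T - S)‖ + ‖productExpectation N θ φ Λ₀ (T - S)‖ :=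
        norm_sub_le _ _
    _ ≤ ‖(T : ConfigSpace L N →L[ℂ] ConfigSpace L N) - S‖ +
        ‖(T : ConfigSpace L N →L[ℂ] ConfigSpace L N) - S‖ := by
        gcongr <;> exact norm_productExpectation_le N θ φ _ _
    _ < ε := by linarith

/-- The product `ω = ⨂_x ⟨(θ_x, φ_x)| · |(θ_x, φ_x)⟩` of coherent states, a bounded linear
functional on the quasi-local algebra. It is the limit over finite `Λ ⊆ L` of the expectations in
the vectors that agree with the coherent product vector on `Λ`; on a local observable these
expectations are eventually constant. -/
def coherentState (N : ℕ) (θ φ : L → ℝ) : quasiLocalAlgebra L N →L[ℂ] ℂ :=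
  LinearMap.mkContinuous
    { toFun := fun T => limUnder atTop fun Λ =>
        productExpectation N θ φ Λ (T : ConfigSpace L N →L[ℂ] ConfigSpace L N)
      map_add' := fun S T => by
        refine Tendsto.limUnder_eq ?_
        have := (tendsto_productExpectation N θ φ S).add (tendsto_productExpectation N θ φ T)
        simpa [productExpectation, inner_add_right] using this
      map_smul' := fun c T => by
        refine Tendsto.limUnder_eq ?_
        have := (tendsto_productExpectation N θ φ T).const_mul c
        simpa [productExpectation, inner_smul_right] using this }
    1 (fun T => by
      rw [one_mul]
      exact le_of_tendsto (tendsto_productExpectation N θ φ T).norm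
        (Eventually.of_forall fun Λ => norm_productExpectation_le N θ φ Λ _))

/-- `ω(∏ A_x) = ∏ ⟨(θ_x, φ_x)| A_x |(θ_x, φ_x)⟩` for one-site observables at distinct sites. -/
theorem coherentState_prod (N : ℕ) (θ φ : L → ℝ) (A : L → Matrix (Fin (N + 1)) (Fin (N + 1)) ℂ)
    (l : List L) (hl : l.Nodup) :
    coherentState N θ φ (l.map fun x => siteObs x (A x)).prod =
      (l.map fun x => siteExpectation N (θ x) (φ x) (A x)).prod := by
  have key : ∀ l : List L, l.Nodup →
      productExpectation N θ φ l.toFinset (l.map fun x => siteOp x (A x)).prod =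
      (l.map fun x => siteExpectation N (θ x) (φ x) (A x)).prod ∧
      ∀ y ∉ l.toFinset, ∀ B : Matrix (Fin (N + 1)) (Fin (N + 1)) ℂ,
        Commute (l.map fun x => siteOp x (A x)).prod (siteOp y B) := by
    intro l
    induction l with
    | nil =>
      intro _
      refine ⟨?_, fun y _ B => Commute.one_left _⟩
      simp [productExpectation, inner_self_eq_norm_sq_to_K, norm_productVector]
    | cons y l ih =>
      intro hl
      rw [List.nodup_cons] at hl
      obtain ⟨h1, h2⟩ := ih hl.2
      have hy : y ∉ l.toFinset := by simpa using hl.1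
      refine ⟨?_, fun z hz B => ?_⟩
      · rw [List.map_cons, List.prod_cons, ← (h2 y hy (A y)).eq, List.toFinset_cons,
          List.map_cons, List.prod_cons, ← h1]
        exact inner_productVector_insert N θ φ l.toFinset hy _ (h2 y hy) (A y)
      · rw [List.map_cons, List.prod_cons]
        simp only [List.toFinset_cons, Finset.mem_insert, not_or] at hz
        exact (siteOp_commute (Ne.symm hz.1) _ _).mul_left (h2 z hz.2 B)
  refine Tendsto.limUnder_eq (tendsto_const_nhds.congr' ?_)
  filter_upwards [eventually_ge_atTop l.toFinset] with Λ hΛ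
  have hcoe : (((l.map fun x => siteObs x (A x)).prod : quasiLocalAlgebra L N) :
      ConfigSpace L N →L[ℂ] ConfigSpace L N) = (l.map fun x => siteOp x (A x)).prod := by
    rw [← StarSubalgebra.subtype_apply, map_list_prod, List.map_map]
    rfl
  rw [hcoe, ← (key l hl).1]
  exact (inner_productVector_of_subset N θ φ l.toFinset _ (key l hl).2 hΛ).symm

/-! ### Spin operators and fluctuation operators -/

/-- The magnetic quantum number `m = J - a`, `J = N / 2`. -/
def magneticNumber (N : ℕ) (a : Fin (N + 1)) : ℝ := (N : ℝ) / 2 - (a : ℕ)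

/-- `S⁺ |m⟩ = √(J(J+1) - m(m+1)) |m+1⟩`. -/
def spinRaise (N : ℕ) : Matrix (Fin (N + 1)) (Fin (N + 1)) ℂ :=
  Matrix.of fun b a => if (a : ℕ) = b + 1 then
    (√((N : ℝ) / 2 * (N / 2 + 1) - magneticNumber N a * (magneticNumber N a + 1)) : ℝ) else 0

/-- `S⁻ |m⟩ = √(J(J+1) - m(m-1)) |m-1⟩`. -/
def spinLower (N : ℕ) : Matrix (Fin (N + 1)) (Fin (N + 1)) ℂ :=
  Matrix.of fun b a => if (b : ℕ) = a + 1 then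
    (√((N : ℝ) / 2 * (N / 2 + 1) - magneticNumber N a * (magneticNumber N a - 1)) : ℝ) else 0

/-- The spin-`J` matrices `S¹, S², S³` with `S^± = S¹ ± i S²` and `S³ |m⟩ = m |m⟩`. -/
def spinMatrix (N : ℕ) : Fin 3 → Matrix (Fin (N + 1)) (Fin (N + 1)) ℂ :=
  ![(1 / 2 : ℂ) • (spinRaise N + spinLower N),
    (1 / (2 * Complex.I)) • (spinRaise N - spinLower N),
    Matrix.diagonal fun a => (magneticNumber N a : ℂ)]

/-- The observable `w · S_x` for `w ∈ ℝ³`. -/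
def spinDot (N : ℕ) (x : L) (w : EuclideanSpace ℝ (Fin 3)) : quasiLocalAlgebra L N :=
  ∑ i, (w i : ℂ) • siteObs x (spinMatrix N i)

/-- The space `ℓ¹₃(L)` of summable families of vectors in `ℝ³`, with norm `|v|₁`. -/
abbrev SummableField (L : Type*) : Type _ := lp (fun _ : L => EuclideanSpace ℝ (Fin 3)) 1

/-- The fluctuation observable `F_J(v) = √(2/J) ∑_x [v_x · S_x - ω(v_x · S_x)]`, `J = N / 2`;
the sum converges in norm in the quasi-local algebra. -/
def fluctuation (N : ℕ) (θ φ : L → ℝ) (v : SummableField L) : quasiLocalAlgebra L N :=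
  ((√(2 / ((N : ℝ) / 2)) : ℝ) : ℂ) • ∑' x, (spinDot N x (v x) -
    algebraMap ℂ (quasiLocalAlgebra L N) (coherentState N θ φ (spinDot N x (v x))))

theorem norm_spinDot_le (N : ℕ) : ∃ C : ℝ, ∀ (x : L) (w : EuclideanSpace ℝ (Fin 3)),
    ‖spinDot N x w‖ ≤ C * ‖w‖ := by
  refine ⟨∑ i, √(∑ a, ∑ m, ‖spinMatrix N i a m‖ ^ 2) * (N + 1), fun x w => ?_⟩
  rw [Finset.sum_mul]
  refine norm_sum_le_of_le _ fun i _ => ?_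
  rw [norm_smul, mul_comm]
  gcongr
  · exact norm_siteOp_le x (spinMatrix N i)
  · rw [Complex.norm_real]
    exact PiLp.norm_apply_le w i

theorem summable_fluctuation (N : ℕ) (θ φ : L → ℝ) (v : SummableField L) :
    Summable fun x => spinDot N x (v x) -
      algebraMap ℂ (quasiLocalAlgebra L N) (coherentState N θ φ (spinDot N x (v x))) := by
  obtain ⟨C, hC⟩ := norm_spinDot_le (L := L) N
  have hv : Summable fun x => ‖v x‖ := by simpa using (lp.memℓp v).summable (by simp)
  have h : Summable fun x => spinDot N x (v x) :=
    Summable.of_norm_bounded (hv.mul_left C) fun x => hC x (v x)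
  refine h.sub ?_
  simp only [Algebra.algebraMap_eq_smul_one]
  exact ((coherentState N θ φ).summable h).smul_const 1

end SpinSystem

section BosonSystem

variable {L : Type*}

/-! ### The limiting boson system -/

/-- The bosonic Fock space over `ℓ²(L)` in the occupation number representation: `ψ n` is the
coordinate of `ψ` along the normalized vector with `n x` particles at the site `x`. -/
abbrev Fock (L : Type*) : Type _ := lp (fun _ : L →₀ ℕ => ℂ) 2

/-- The vectors with a bounded number of particles; a common invariant core of the field
operators. -/
def finiteParticle (L : Type*) : Submodule ℂ (Fock L) where
  carrier := {ψ | ∃ K : ℕ, ∀ n : L →₀ ℕ, K < n.degree → ψ n = 0}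
  add_mem' := by
    rintro ψ χ ⟨K, hK⟩ ⟨M, hM⟩
    refine ⟨max K M, fun n hn => ?_⟩
    rw [max_lt_iff] at hn
    simp [hK n hn.1, hM n hn.2]
  zero_mem' := ⟨0, fun n _ => rfl⟩
  smul_mem' := by
    rintro c ψ ⟨K, hK⟩
    exact ⟨K, fun n hn => by simp [hK n hn]⟩

/-- Coordinates of `a^*(w) ψ = ∑_x w_x a^*_x ψ`. -/
def creationFun (w : L → ℂ) (ψ : (L →₀ ℕ) → ℂ) (n : L →₀ ℕ) : ℂ :=
  ∑ x ∈ n.support, w x * (√(n x : ℝ) : ℂ) * ψ (n - Finsupp.single x 1)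

/-- Coordinates of `a(w) ψ = ∑_x (conj w_x) a_x ψ`. -/
def annihilationFun (w : L → ℂ) (ψ : (L →₀ ℕ) → ℂ) (n : L →₀ ℕ) : ℂ :=
  ∑' x, (starRingEnd ℂ) (w x) * (√((n x : ℝ) + 1) : ℂ) * ψ (n + Finsupp.single x 1)

theorem memℓp_two_iff_tsum {ι : Type*} {f : ι → ℂ} :
    Memℓp f 2 ↔ ∑' i, ‖f i‖ₑ ^ 2 ≠ ∞ := by
  rw [memℓp_gen_iff (by simp)]
  simp only [ENNReal.toReal_ofNat, Real.rpow_ofNat]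
  have : ∀ i, ‖f i‖ₑ ^ 2 = ‖(‖f i‖ ^ 2 : ℝ)‖ₑ := fun i => by simp [enorm_pow]
  simp_rw [this, tsum_enorm_ne_top_iff_summable_norm]
  simp

theorem ennreal_sum_mul_sq_le {ι : Type*} (s : Finset ι) (f g : ι → ℝ≥0∞) :
    (∑ i ∈ s, f i * g i) ^ 2 ≤ (∑ i ∈ s, f i ^ 2) * ∑ i ∈ s, g i ^ 2 := by
  have h := ENNReal.inner_le_Lp_mul_Lq s f g Real.HolderConjugate.two_two
  calc _ ≤ ((∑ i ∈ s, f i ^ (2 : ℝ)) ^ (1 / (2 : ℝ)) * (∑ i ∈ s, g i ^ (2 : ℝ)) ^ (1 / (2 : ℝ))) ^ 2 := by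
        gcongr
    _ = _ := by
        rw [mul_pow, ← ENNReal.rpow_natCast, ← ENNReal.rpow_natCast, ← ENNReal.rpow_mul,
          ← ENNReal.rpow_mul]
        simp

theorem ennreal_tsum_mul_sq_le {ι : Type*} (f g : ι → ℝ≥0∞) :
    (∑' i, f i * g i) ^ 2 ≤ (∑' i, f i ^ 2) * ∑' i, g i ^ 2 := by
  refine le_of_tendsto ((ENNReal.continuous_pow 2).tendsto _ |>.comp ENNReal.summable.hasSum)
    (Eventually.of_forall fun s => ?_)
  refine (ennreal_sum_mul_sq_le s f g).trans ?_
  gcongr <;> exact ENNReal.sum_le_tsum s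

theorem enorm_sqrt_sq (r : ℝ) (hr : 0 ≤ r) : ‖((√r : ℝ) : ℂ)‖ₑ ^ 2 = ENNReal.ofReal r := by
  rw [← ofReal_norm, ← ENNReal.ofReal_pow (norm_nonneg _), Complex.norm_real, Real.norm_eq_abs,
    sq_abs, Real.sq_sqrt hr]

/-- Reindexing by adding a particle at `x`. -/
theorem tsum_shift (x : L) (q : (L →₀ ℕ) → ℝ≥0∞) (hq : ∀ n, n x = 0 → q n = 0) :
    ∑' n, q n = ∑' m, q (m + Finsupp.single x 1) := by
  refine (Function.Injective.tsum_eq (add_left_injective (Finsupp.single x 1)) ?_).symm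
  intro n hn
  refine ⟨n - Finsupp.single x 1, Finsupp.sub_add_single_one_cancel fun h => hn (hq n h)⟩

theorem creation_bound (w : L → ℂ) (ψ : (L →₀ ℕ) → ℂ) (K : ℕ)
    (hK : ∀ n : L →₀ ℕ, K < n.degree → ψ n = 0) :
    ∑' n, ‖creationFun w ψ n‖ₑ ^ 2 ≤
      (K + 1 : ℕ) * ((∑' x, ‖w x‖ₑ ^ 2) * ∑' n, ‖ψ n‖ₑ ^ 2) := by
  classical
  have hpt : ∀ n, ‖creationFun w ψ n‖ₑ ^ 2 ≤ ((K + 1 : ℕ) : ℝ≥0∞) *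
      ∑' x, if n x = 0 then 0 else ‖w x‖ₑ ^ 2 * ‖ψ (n - Finsupp.single x 1)‖ₑ ^ 2 := by
    intro n
    by_cases hn : n.degree ≤ K + 1
    · calc _ ≤ (∑ x ∈ n.support, ‖((√(n x : ℝ) : ℝ) : ℂ)‖ₑ *
              (‖w x‖ₑ * ‖ψ (n - Finsupp.single x 1)‖ₑ)) ^ 2 := by
            gcongr
            refine (enorm_sum_le _ _).trans (le_of_eq ?_)
            refine Finset.sum_congr rfl fun x _ => ?_
            rw [enorm_mul, enorm_mul]; ring
        _ ≤ _ := ennreal_sum_mul_sq_le _ _ _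
        _ ≤ _ := by
            gcongr
            · simp_rw [enorm_sqrt_sq _ (Nat.cast_nonneg _), ENNReal.ofReal_natCast]
              rw [← Nat.cast_sum, ← Finsupp.degree_apply]
              exact_mod_cast hn
            · refine le_trans (le_of_eq ?_) (ENNReal.sum_le_tsum n.support)
              refine Finset.sum_congr rfl fun x hx => ?_
              rw [if_neg (Finsupp.mem_support_iff.1 hx), mul_pow]
    · have : creationFun w ψ n = 0 := by
        refine Finset.sum_eq_zero fun x hx => ?_
        have h1 := Finsupp.sub_add_single_one_cancel (Finsupp.mem_support_iff.1 hx)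
        have h2 := congrArg Finsupp.degree h1
        rw [map_add, Finsupp.degree_single] at h2
        rw [hK _ (by omega), mul_zero]
      simp [this]
  calc _ ≤ ∑' n : L →₀ ℕ, ((K + 1 : ℕ) : ℝ≥0∞) * ∑' x, if n x = 0 then 0 else
          ‖w x‖ₑ ^ 2 * ‖ψ (n - Finsupp.single x 1)‖ₑ ^ 2 := ENNReal.tsum_le_tsum hpt
    _ = _ := by
      rw [ENNReal.tsum_mul_left, ENNReal.tsum_comm, ← ENNReal.tsum_mul_right]
      congr 1
      refine tsum_congr fun x => ?_
      rw [tsum_shift x _ (fun n hn => by simp [hn]), ← ENNReal.tsum_mul_left]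
      refine tsum_congr fun m => ?_
      simp

theorem annihilation_bound (w : L → ℂ) (ψ : (L →₀ ℕ) → ℂ) (K : ℕ)
    (hK : ∀ n : L →₀ ℕ, K < n.degree → ψ n = 0) :
    ∑' n, ‖annihilationFun w ψ n‖ₑ ^ 2 ≤
      K * ((∑' x, ‖w x‖ₑ ^ 2) * ∑' n, ‖ψ n‖ₑ ^ 2) := by
  classical
  have hpt : ∀ n, ‖annihilationFun w ψ n‖ₑ ^ 2 ≤ (∑' x, ‖w x‖ₑ ^ 2) *
      ∑' x, ((n x + 1 : ℕ) : ℝ≥0∞) * ‖ψ (n + Finsupp.single x 1)‖ₑ ^ 2 := by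
    intro n
    calc _ ≤ (∑' x, ‖w x‖ₑ *
            (‖((√((n x : ℝ) + 1) : ℝ) : ℂ)‖ₑ * ‖ψ (n + Finsupp.single x 1)‖ₑ)) ^ 2 := by
          gcongr
          refine enorm_tsum_le_tsum_enorm.trans (le_of_eq ?_)
          refine tsum_congr fun x => ?_
          rw [enorm_mul, enorm_mul, RCLike.enorm_conj]; ring
      _ ≤ _ := ennreal_tsum_mul_sq_le _ _
      _ = _ := by
          congr 1
          refine tsum_congr fun x => ?_
          rw [mul_pow, enorm_sqrt_sq _ (by positivity)]
          congr 1
          rw [← ENNReal.ofReal_natCast]; push_cast; rfl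
  calc _ ≤ ∑' n : L →₀ ℕ, (∑' x, ‖w x‖ₑ ^ 2) *
        ∑' x, ((n x + 1 : ℕ) : ℝ≥0∞) * ‖ψ (n + Finsupp.single x 1)‖ₑ ^ 2 :=
        ENNReal.tsum_le_tsum hpt
    _ = (∑' x, ‖w x‖ₑ ^ 2) * ∑' m : L →₀ ℕ, (m.degree : ℝ≥0∞) * ‖ψ m‖ₑ ^ 2 := by
      rw [ENNReal.tsum_mul_left, ENNReal.tsum_comm]
      congr 1
      have : ∀ x, ∑' n : L →₀ ℕ, ((n x + 1 : ℕ) : ℝ≥0∞) * ‖ψ (n + Finsupp.single x 1)‖ₑ ^ 2 =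
          ∑' m : L →₀ ℕ, (m x : ℝ≥0∞) * ‖ψ m‖ₑ ^ 2 := by
        intro x
        rw [tsum_shift x (fun m => (m x : ℝ≥0∞) * ‖ψ m‖ₑ ^ 2) (fun n hn => by simp [hn])]
        refine tsum_congr fun n => ?_
        simp
      simp_rw [this]
      rw [ENNReal.tsum_comm]
      refine tsum_congr fun m => ?_
      rw [ENNReal.tsum_mul_right, tsum_eq_sum (s := m.support) (by simp), Finsupp.degree_apply]
      push_cast; rfl
    _ ≤ (∑' x, ‖w x‖ₑ ^ 2) * ∑' m : L →₀ ℕ, (K : ℝ≥0∞) * ‖ψ m‖ₑ ^ 2 := by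
      refine mul_le_mul_right (ENNReal.tsum_le_tsum fun m => ?_) _
      by_cases hm : m.degree ≤ K
      · gcongr
      · rw [hK m (by omega)]; simp

    _ = _ := by rw [ENNReal.tsum_mul_left]; ring

theorem summable_annihilation (w : lp (fun _ : L => ℂ) 2) (ψ : Fock L) (n : L →₀ ℕ) :
    Summable fun x => (starRingEnd ℂ) (w x) * (√((n x : ℝ) + 1) : ℂ) *
      ψ (n + Finsupp.single x 1) := by
  have hw : Summable fun x => ‖w x‖ ^ 2 := by simpa using (lp.memℓp w).summable (by simp)
  have hψ : Summable fun m => ‖ψ m‖ ^ 2 := by simpa using (lp.memℓp ψ).summable (by simp)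
  have hinj : Function.Injective fun x => n + Finsupp.single x 1 := fun x y h =>
    Finsupp.single_left_injective one_ne_zero (add_left_cancel h)
  refine Summable.of_norm_bounded
    ((hw.mul_left ((n.degree : ℝ) + 1)).add (hψ.comp_injective hinj)) fun x => ?_
  have h1 : (n x : ℝ) ≤ n.degree := by exact_mod_cast Finsupp.le_degree x n
  have h2 : √((n x : ℝ) + 1) ^ 2 = n x + 1 := Real.sq_sqrt (by positivity)
  simp only [norm_mul, RCLike.norm_conj, Complex.norm_real, Real.norm_eq_abs,
    abs_of_nonneg (Real.sqrt_nonneg _), Function.comp]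
  nlinarith [sq_nonneg (‖w x‖ * √((n x : ℝ) + 1) - ‖ψ (n + Finsupp.single x 1)‖),
    mul_le_mul_of_nonneg_left h1 (sq_nonneg ‖w x‖), sq_nonneg (‖w x‖ * √((n x : ℝ) + 1)),
    sq_nonneg ‖ψ (n + Finsupp.single x 1)‖]

/-- The creation operator `a^*(w) = ∑_x w_x a^*_x`, `w ∈ ℓ²(L)`, where `a^*_x` maps the
normalized occupation number vector `n` to `√(n_x + 1)` times that of `n + δ_x`. -/
def creation (w : lp (fun _ : L => ℂ) 2) : Module.End ℂ (finiteParticle L) where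
  toFun ψ := ⟨⟨creationFun w ψ.1, by
      obtain ⟨K, hK⟩ := ψ.2
      refine memℓp_two_iff_tsum.2 (ne_top_of_le_ne_top ?_ (creation_bound w ψ.1 K hK))
      exact ENNReal.mul_ne_top (ENNReal.natCast_ne_top _) (ENNReal.mul_ne_top
        (memℓp_two_iff_tsum.1 (lp.memℓp w)) (memℓp_two_iff_tsum.1 (lp.memℓp ψ.1)))⟩, by
    obtain ⟨K, hK⟩ := ψ.2
    refine ⟨K + 1, fun n hn => Finset.sum_eq_zero fun x hx => ?_⟩
    have h2 := congrArg Finsupp.degree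
      (Finsupp.sub_add_single_one_cancel (Finsupp.mem_support_iff.1 hx))
    rw [map_add, Finsupp.degree_single] at h2
    rw [hK _ (by omega), mul_zero]⟩
  map_add' ψ χ := by
    refine Subtype.ext (lp.ext (funext fun n => ?_))
    simp [creationFun, mul_add, Finset.sum_add_distrib]
    rfl
  map_smul' c ψ := by
    refine Subtype.ext (lp.ext (funext fun n => ?_))
    simp [creationFun, Finset.mul_sum, mul_left_comm]

/-- The annihilation operator `a(w) = ∑_x (conj w_x) a_x`, `w ∈ ℓ²(L)`, where `a_x` maps the
normalized occupation number vector `n` to `√n_x` times that of `n - δ_x`. -/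
def annihilation (w : lp (fun _ : L => ℂ) 2) : Module.End ℂ (finiteParticle L) where
  toFun ψ := ⟨⟨annihilationFun w ψ.1, by
      obtain ⟨K, hK⟩ := ψ.2
      refine memℓp_two_iff_tsum.2 (ne_top_of_le_ne_top ?_ (annihilation_bound w ψ.1 K hK))
      exact ENNReal.mul_ne_top (ENNReal.natCast_ne_top _) (ENNReal.mul_ne_top
        (memℓp_two_iff_tsum.1 (lp.memℓp w)) (memℓp_two_iff_tsum.1 (lp.memℓp ψ.1)))⟩, by
    obtain ⟨K, hK⟩ := ψ.2
    refine ⟨K, fun n hn => ?_⟩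
    refine (tsum_congr fun x => ?_).trans tsum_zero
    rw [hK _ (by rw [map_add, Finsupp.degree_single]; omega), mul_zero]⟩
  map_add' ψ χ := by
    refine Subtype.ext (lp.ext (funext fun n => ?_))
    simp only [annihilationFun, Submodule.coe_add, lp.coeFn_add, Pi.add_apply, mul_add]
    exact (summable_annihilation w ψ.1 n).tsum_add (summable_annihilation w χ.1 n)
  map_smul' c ψ := by
    refine Subtype.ext (lp.ext (funext fun n => ?_))
    simp only [annihilationFun, Submodule.coe_smul, lp.coeFn_smul, Pi.smul_apply, smul_eq_mul,
      RingHom.id_apply, ← tsum_mul_left]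
    exact tsum_congr fun x => by ring

/-- The boson field operator `F(w) = ∑_x [w_x a^*_x + (conj w_x) a_x]`, `w ∈ ℓ²(L)`. -/
def bosonField (w : lp (fun _ : L => ℂ) 2) : Module.End ℂ (finiteParticle L) :=
  creation w + annihilation w

open Classical in
/-- The Fock vacuum. -/
def vacuum (L : Type*) : finiteParticle L :=
  ⟨lp.single 2 (0 : L →₀ ℕ) (1 : ℂ), 0, fun n hn => by
    refine lp.single_apply_ne _ _ _ ?_
    rintro rfl
    simp at hn⟩

/-- The Fock state `ω̃(T) = ⟨Ω̃, T Ω̃⟩`. -/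
def fockState (T : Module.End ℂ (finiteParticle L)) : ℂ :=
  ⟪(vacuum L : Fock L), (T (vacuum L) : Fock L)⟫_ℂ

/-! ### Projection to the tangent planes -/

/-- The first rotated basis vector. -/
def tangentBasis₁ (θ φ : ℝ) : EuclideanSpace ℝ (Fin 3) :=
  !₂[Real.cos θ * Real.cos φ, Real.cos θ * Real.sin φ, -Real.sin θ]

/-- The second rotated basis vector. -/
def tangentBasis₂ (φ : ℝ) : EuclideanSpace ℝ (Fin 3) :=
  !₂[-Real.sin φ, Real.cos φ, 0]

/-- The projection of `w ∈ ℝ³` onto the plane orthogonal to the unit vector with spherical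
coordinates `(θ, φ)`, in the rotated basis, with `ℝ²` identified with `ℂ`. -/
def tangentCoord (θ φ : ℝ) (w : EuclideanSpace ℝ (Fin 3)) : ℂ :=
  (⟪tangentBasis₁ θ φ, w⟫_ℝ : ℂ) + Complex.I * (⟪tangentBasis₂ φ, w⟫_ℝ : ℂ)

theorem norm_tangentCoord_le (θ φ : ℝ) (w : EuclideanSpace ℝ (Fin 3)) :
    ‖tangentCoord θ φ w‖ ≤ 2 * ‖w‖ := by
  have h1 : ‖tangentBasis₁ θ φ‖ = 1 := by
    rw [EuclideanSpace.norm_eq, Real.sqrt_eq_one]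
    simp only [tangentBasis₁, Fin.sum_univ_three, Real.norm_eq_abs, sq_abs]
    simp
    nlinarith [Real.sin_sq_add_cos_sq θ, Real.sin_sq_add_cos_sq φ]
  have h2 : ‖tangentBasis₂ φ‖ = 1 := by
    rw [EuclideanSpace.norm_eq, Real.sqrt_eq_one]
    simp [tangentBasis₂, Fin.sum_univ_three]
  have h3 := abs_real_inner_le_norm (tangentBasis₁ θ φ) w
  have h4 := abs_real_inner_le_norm (tangentBasis₂ φ) w
  refine (norm_add_le _ _).trans ?_
  rw [norm_mul, Complex.norm_I, Complex.norm_real, Complex.norm_real, Real.norm_eq_abs,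
    Real.norm_eq_abs]
  rw [h1] at h3
  rw [h2] at h4
  linarith

/-- The family `ṽ ∈ ℓ²(L)` of tangential components `ṽ_x = ṽ¹_x + i ṽ²_x` of `v ∈ ℓ¹₃(L)`. -/
def tangentField (θ φ : L → ℝ) (v : SummableField L) : lp (fun _ : L => ℂ) 2 :=
  ⟨fun x => tangentCoord (θ x) (φ x) (v x), by
    refine Memℓp.of_exponent_ge (q := 1) (memℓp_gen ?_) (by norm_num)
    have hv : Summable fun x => ‖v x‖ := by simpa using (lp.memℓp v).summable (by simp)
    simpa using Summable.of_norm_bounded (hv.mul_left 2)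
      (fun x => by simpa using norm_tangentCoord_le (θ x) (φ x) (v x))⟩

end BosonSystem

end SpinFluctuations

end

open SpinFluctuations

noncomputable section

namespace SpinFluctuations

open scoped Matrix

/-! Write N = 2J. A rotation at each site takes the basis vector |J⟩ to the coherent vector, and
turns w · S into the same combination of S⁺, S⁻ and S³ with w expressed in the rotated frame:
tangential part z = `tangentCoord`, radial part r = `radialCoord`. Expectations in the coherent
state thus become expectations in ⨂ |J⟩ of operators with coefficients z and r
(`coherentState_prod_fluctuation`).

In that frame the Holstein–Primakoff picture applies. The label a = J - m at a site is an occupation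
number, ⨂ |J⟩ is the vacuum, and after scaling by √(2/J) the lowering operator has matrix elements
√(a + 1) √(1 - a/N), while the centered radial part is diagonal with entries -2a/√N. As N grows, the
first tends to the matrix element of a boson creation operator and the second tends to 0. Both
systems are therefore described by one family of ladder operators `siteLadder`, which differ only in
the coefficients (`hasSum_framedFluctuation`, `hasSum_bosonField`).

These operators are not bounded uniformly in N, but each application adds at most one particle, and
on vectors with at most K particles `exists_ladder` bounds them by the coefficients at occupation
numbers up to K. Let T be the spin operator and F the boson operator for the leftmost factor, and
let ψ and ξ be the vectors made by the other k factors from the two vacua. Then Tψ - Fξ = T(ψ - ξ) +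
(T - F)ξ, where T costs 4√(k + 1) |v|₁, T - F costs 4√(k + 1) √k |v|₁/√N, and ‖ξ‖ ≤ 2^k √(k!) ∏
|v_j|₁. Iterating this recursion gives exactly the stated sum (`errorSum_succ`,
`exists_framedFluctuation_approx`). The expectations are the vacuum coordinates of the two vectors,
so the norm estimate implies the theorem. -/

/-! ### Ladder matrices -/

/-- The matrix element `√(J(J+1) - m(m-1))` of `S⁻` at `m = J - a`, `J = N / 2`. -/
def ladderCoeff (N a : ℕ) : ℝ := √(((a : ℝ) + 1) * ((N : ℝ) - a))

theorem ladderCoeff_sq {N a : ℕ} (h : a ≤ N) :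
    ladderCoeff N a ^ 2 = ((a : ℝ) + 1) * ((N : ℝ) - a) := by
  have : (a : ℝ) ≤ N := by exact_mod_cast h
  exact Real.sq_sqrt (mul_nonneg (by positivity) (by linarith))

theorem ladderCoeff_self (N : ℕ) : ladderCoeff N N = 0 := by simp [ladderCoeff]

theorem ladderCoeff_pos {N a : ℕ} (h : a < N) : 0 < ladderCoeff N a := by
  have : (a : ℝ) < N := by exact_mod_cast h
  exact Real.sqrt_pos.2 (mul_pos (by positivity) (by linarith))

theorem spinRaise_apply (N : ℕ) (b a : Fin (N + 1)) :
    spinRaise N b a = if (a : ℕ) = b + 1 then (ladderCoeff N b : ℂ) else 0 := by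
  rw [spinRaise, Matrix.of_apply]
  split_ifs with h
  · rw [ladderCoeff, magneticNumber, h]
    congr 3
    push_cast
    ring
  · rfl

theorem spinLower_apply (N : ℕ) (b a : Fin (N + 1)) :
    spinLower N b a = if (b : ℕ) = a + 1 then (ladderCoeff N a : ℂ) else 0 := by
  rw [spinLower, Matrix.of_apply]
  split_ifs with h
  · rw [ladderCoeff, magneticNumber]
    congr 3
    ring
  · rfl

theorem conjTranspose_spinRaise (N : ℕ) : (spinRaise N)ᴴ = spinLower N := by
  ext b a
  rw [Matrix.conjTranspose_apply, spinRaise_apply, spinLower_apply]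
  split_ifs <;> simp

/-- The matrix `S³`. -/
def spinAxis (N : ℕ) : Matrix (Fin (N + 1)) (Fin (N + 1)) ℂ :=
  Matrix.diagonal fun a => (magneticNumber N a : ℂ)

theorem conjTranspose_spinAxis (N : ℕ) : (spinAxis N)ᴴ = spinAxis N := by
  rw [spinAxis, Matrix.diagonal_conjTranspose]
  congr 1
  ext a
  simp

theorem sum_fin_eq_succ {N : ℕ} (b : ℕ) (g : Fin (N + 1) → ℂ) :
    ∑ a : Fin (N + 1), (if (a : ℕ) = b + 1 then g a else 0) =
      if h : b + 1 < N + 1 then g ⟨b + 1, h⟩ else 0 := by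
  split_ifs with h
  · rw [Finset.sum_eq_single ⟨b + 1, h⟩]
    · simp
    · intro a _ ha
      rw [if_neg]
      exact fun h' => ha (Fin.ext h')
    · simp
  · refine Finset.sum_eq_zero fun a _ => if_neg ?_
    have := a.2
    omega

theorem sum_fin_succ_eq {N : ℕ} (b : Fin (N + 1)) (g : Fin (N + 1) → ℂ) :
    ∑ a : Fin (N + 1), (if (b : ℕ) = a + 1 then g a else 0) =
      if (b : ℕ) = 0 then 0 else g ⟨b - 1, by omega⟩ := by
  split_ifs with h
  · exact Finset.sum_eq_zero fun a _ => if_neg (by omega)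
  · rw [Finset.sum_eq_single ⟨b - 1, by omega⟩]
    · rw [if_pos]; dsimp only; omega
    · intro a _ ha
      rw [if_neg]
      exact fun h' => ha (Fin.ext (by dsimp only; omega))
    · simp

theorem spinRaise_mulVec (N : ℕ) (f : Fin (N + 1) → ℂ) (b : Fin (N + 1)) :
    (spinRaise N *ᵥ f) b =
      if h : (b : ℕ) + 1 < N + 1 then ladderCoeff N b * f ⟨b + 1, h⟩ else 0 := by
  rw [← sum_fin_eq_succ (b : ℕ) fun a => (ladderCoeff N b : ℂ) * f a]
  simp [Matrix.mulVec, dotProduct, spinRaise_apply]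

theorem spinLower_mulVec (N : ℕ) (f : Fin (N + 1) → ℂ) (b : Fin (N + 1)) :
    (spinLower N *ᵥ f) b =
      if (b : ℕ) = 0 then 0 else ladderCoeff N (b - 1) * f ⟨b - 1, by omega⟩ := by
  rw [← sum_fin_succ_eq b fun a => (ladderCoeff N a : ℂ) * f a]
  simp [Matrix.mulVec, dotProduct, spinLower_apply]

theorem spinAxis_mulVec (N : ℕ) (f : Fin (N + 1) → ℂ) (b : Fin (N + 1)) :
    (spinAxis N *ᵥ f) b = ((N : ℂ) / 2 - (b : ℕ)) * f b := by
  simp [spinAxis, Matrix.mulVec_diagonal, magneticNumber]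

theorem spinAxis_mul_spinRaise (N : ℕ) :
    spinAxis N * spinRaise N = spinRaise N * spinAxis N + spinRaise N := by
  ext b a
  simp only [spinAxis, Matrix.diagonal_mul, Matrix.add_apply, Matrix.mul_diagonal,
    spinRaise_apply, magneticNumber]
  split_ifs with h
  · rw [h]; push_cast; ring
  · ring

theorem spinAxis_mul_spinLower (N : ℕ) :
    spinAxis N * spinLower N = spinLower N * spinAxis N - spinLower N := by
  ext b a
  simp only [spinAxis, Matrix.diagonal_mul, Matrix.sub_apply, Matrix.mul_diagonal,
    spinLower_apply, magneticNumber]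
  split_ifs with h
  · rw [h]; push_cast; ring
  · ring

/-- On the diagonal this is (a + 1)(N - a) - a(N - a + 1) = N - 2a. The cutoff at the last index
does no harm because the ladder coefficient vanishes there. -/
theorem spinRaise_mul_spinLower (N : ℕ) :
    spinRaise N * spinLower N = spinLower N * spinRaise N + (2 : ℂ) • spinAxis N := by
  refine Matrix.ext_iff_mulVec.2 fun f => funext fun b => ?_
  have hsq : ∀ a ≤ N, (ladderCoeff N a : ℂ) ^ 2 = ((a : ℂ) + 1) * ((N : ℂ) - a) := fun a h => by
    exact_mod_cast congrArg (fun r : ℝ => (r : ℂ)) (ladderCoeff_sq h)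
  rw [Matrix.add_mulVec, Matrix.smul_mulVec, ← Matrix.mulVec_mulVec, ← Matrix.mulVec_mulVec,
    Pi.add_apply, Pi.smul_apply, spinAxis_mulVec, spinRaise_mulVec, spinLower_mulVec]
  obtain ⟨b, hb⟩ := b
  have h1 : (if h : b + 1 < N + 1 then (ladderCoeff N b : ℂ) *
      (spinLower N *ᵥ f) ⟨b + 1, h⟩ else 0) = (ladderCoeff N b : ℂ) ^ 2 * f ⟨b, hb⟩ := by
    split_ifs with h
    · rw [spinLower_mulVec]; simp; ring
    · obtain rfl : b = N := by omega
      simp [ladderCoeff_self]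
  simp only
  rw [h1, hsq b (by omega)]
  rcases b with _ | b
  · simp; ring
  · rw [if_neg (by simp), spinRaise_mulVec]
    simp only [Nat.add_sub_cancel]
    rw [dif_pos hb]
    have := hsq b (by omega)
    simp only [smul_eq_mul]
    push_cast
    linear_combination -f ⟨b + 1, hb⟩ * this

/-! ### Rotated spin matrices -/

/-- The component `S¹ + i S²` of the spin along the tangent plane at `(θ, φ)`. -/
def rotRaise (N : ℕ) (θ φ : ℝ) : Matrix (Fin (N + 1)) (Fin (N + 1)) ℂ :=
  ((Real.cos (θ / 2) : ℂ) ^ 2 * Complex.exp (-(Complex.I * φ))) • spinRaise N -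
    ((Real.sin (θ / 2) : ℂ) ^ 2 * Complex.exp (Complex.I * φ)) • spinLower N -
    (2 * (Real.sin (θ / 2) : ℂ) * (Real.cos (θ / 2) : ℂ)) • spinAxis N

/-- The component `S¹ - i S²` of the spin along the tangent plane at `(θ, φ)`. -/
def rotLower (N : ℕ) (θ φ : ℝ) : Matrix (Fin (N + 1)) (Fin (N + 1)) ℂ :=
  ((Real.cos (θ / 2) : ℂ) ^ 2 * Complex.exp (Complex.I * φ)) • spinLower N -
    ((Real.sin (θ / 2) : ℂ) ^ 2 * Complex.exp (-(Complex.I * φ))) • spinRaise N -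
    (2 * (Real.sin (θ / 2) : ℂ) * (Real.cos (θ / 2) : ℂ)) • spinAxis N

/-- The component of the spin in the direction `(θ, φ)`. -/
def rotAxis (N : ℕ) (θ φ : ℝ) : Matrix (Fin (N + 1)) (Fin (N + 1)) ℂ :=
  ((Real.sin (θ / 2) : ℂ) * (Real.cos (θ / 2) : ℂ) * Complex.exp (-(Complex.I * φ))) • spinRaise N +
    ((Real.sin (θ / 2) : ℂ) * (Real.cos (θ / 2) : ℂ) * Complex.exp (Complex.I * φ)) • spinLower N +
    ((Real.cos (θ / 2) : ℂ) ^ 2 - (Real.sin (θ / 2) : ℂ) ^ 2) • spinAxis N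

theorem exp_neg_mul_exp (φ : ℝ) :
    Complex.exp (-(Complex.I * φ)) * Complex.exp (Complex.I * φ) = 1 := by
  rw [← Complex.exp_add]; simp

theorem half_angle (θ : ℝ) :
    (Real.cos (θ / 2) : ℂ) ^ 2 + (Real.sin (θ / 2) : ℂ) ^ 2 = 1 := by
  exact_mod_cast Real.cos_sq_add_sin_sq (θ / 2)

theorem conjTranspose_rotRaise (N : ℕ) (θ φ : ℝ) : (rotRaise N θ φ)ᴴ = rotLower N θ φ := by
  have h : star (Complex.exp (Complex.I * φ)) = Complex.exp (-(Complex.I * φ)) := by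
    rw [RCLike.star_def, ← Complex.exp_conj]; simp
  have h' : star (Complex.exp (-(Complex.I * φ))) = Complex.exp (Complex.I * φ) := by
    rw [← h, star_star]
  have hL : (spinLower N)ᴴ = spinRaise N := by
    rw [← conjTranspose_spinRaise, Matrix.conjTranspose_conjTranspose]
  have hr : ∀ r : ℝ, star (r : ℂ) = r := Complex.conj_ofReal
  simp only [rotRaise, rotLower, Matrix.conjTranspose_sub, Matrix.conjTranspose_smul,
    conjTranspose_spinRaise, conjTranspose_spinAxis, hL, star_mul', star_pow, h, h', hr,
    star_ofNat]

theorem rotRaise_mul_rotLower (N : ℕ) (θ φ : ℝ) :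
    rotRaise N θ φ * rotLower N θ φ =
      rotLower N θ φ * rotRaise N θ φ + (2 : ℂ) • rotAxis N θ φ := by
  have he := exp_neg_mul_exp φ
  have hc := half_angle θ
  simp only [rotRaise, rotLower, rotAxis]
  generalize (Real.cos (θ / 2) : ℂ) = c at *
  generalize (Real.sin (θ / 2) : ℂ) = s at *
  generalize Complex.exp (-(Complex.I * φ)) = e' at *
  generalize Complex.exp (Complex.I * φ) = e at *
  simp only [sub_mul, mul_sub, Matrix.smul_mul, Matrix.mul_smul,
    spinRaise_mul_spinLower, spinAxis_mul_spinLower, spinAxis_mul_spinRaise]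
  -- With the half-angle functions and phases abstracted, each coefficient is a polynomial identity
  -- modulo c² + s² = 1 and e'e = 1.
  match_scalars <;> grind

theorem rotAxis_mul_rotLower (N : ℕ) (θ φ : ℝ) :
    rotAxis N θ φ * rotLower N θ φ =
      rotLower N θ φ * rotAxis N θ φ - rotLower N θ φ := by
  have he := exp_neg_mul_exp φ
  have hc := half_angle θ
  simp only [rotLower, rotAxis]
  generalize (Real.cos (θ / 2) : ℂ) = c at *
  generalize (Real.sin (θ / 2) : ℂ) = s at *
  generalize Complex.exp (-(Complex.I * φ)) = e' at *
  generalize Complex.exp (Complex.I * φ) = e at *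
  simp only [sub_mul, mul_sub, add_mul, mul_add, Matrix.smul_mul, Matrix.mul_smul,
    spinRaise_mul_spinLower, spinAxis_mul_spinLower, spinAxis_mul_spinRaise]
  match_scalars <;> grind

/-! ### The coherent vector has highest weight -/

theorem sqrt_choose_succ {N a : ℕ} (h : a < N) :
    ladderCoeff N a * √(N.choose (a + 1)) = ((N : ℝ) - a) * √(N.choose a) := by
  have hN : (a : ℝ) < N := by exact_mod_cast h
  have hc : (N.choose (a + 1) : ℝ) * (a + 1) = N.choose a * ((N : ℝ) - a) := by
    have := Nat.choose_succ_right_eq N a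
    rw [← Nat.cast_sub h.le]
    exact_mod_cast this
  rw [ladderCoeff, ← Real.sqrt_mul (mul_nonneg (by positivity) (by linarith)),
    ← Real.sqrt_sq (sub_nonneg.2 hN.le), ← Real.sqrt_mul (sq_nonneg _)]
  rw [Real.sqrt_sq (sub_nonneg.2 hN.le)]
  congr 1
  linear_combination ((N : ℝ) - a) * hc

theorem sqrt_choose_pred {N a : ℕ} (h : a < N) :
    ladderCoeff N a * √(N.choose a) = ((a : ℝ) + 1) * √(N.choose (a + 1)) := by
  have hN : (a : ℝ) < N := by exact_mod_cast h
  have h1 := sqrt_choose_succ h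
  have h2 := ladderCoeff_sq h.le
  have h3 : ((N : ℝ) - a) ≠ 0 := by linarith
  apply mul_left_cancel₀ h3
  linear_combination (-ladderCoeff N a) * h1 + √(N.choose (a + 1)) * h2

/-- Consecutive coherent amplitudes have ratio tan(θ/2) e^{iφ} times a binomial factor, so S⁺ and S⁻
act on the coherent vector as multiplication by functions of a. Here and in the companion for S⁻ the
denominators are cleared, which keeps the identities valid at θ = 0 and θ = π. -/
theorem cos_mul_spinRaise_coherentVector (N : ℕ) (θ φ : ℝ) (a : Fin (N + 1)) :
    (Real.cos (θ / 2) : ℂ) * Complex.exp (-(Complex.I * φ)) *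
        (spinRaise N *ᵥ coherentVector N θ φ) a =
      (Real.sin (θ / 2) : ℂ) * ((N : ℂ) - (a : ℕ)) * coherentVector N θ φ a := by
  obtain ⟨a, ha⟩ := a
  rw [spinRaise_mulVec]
  split_ifs with h
  · replace h : a + 1 < N + 1 := h
    have h1 := congrArg (fun r : ℝ => (r : ℂ)) (sqrt_choose_succ (show a < N by omega))
    -- Naming the exponent removes the truncated subtraction: the powers of the cosine at a and a +
    -- 1 become m + 1 and m.
    obtain ⟨m, hm⟩ : ∃ m, N - a = m + 1 := ⟨N - a - 1, by omega⟩
    have hm' : N - (a + 1) = m := by rw [← Nat.sub_sub, hm, Nat.add_sub_cancel]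
    have he : Complex.exp (Complex.I * ((a + 1 : ℕ) : ℂ) * φ) =
        Complex.exp (Complex.I * a * φ) * Complex.exp (Complex.I * φ) := by
      rw [← Complex.exp_add]; congr 1; push_cast; ring
    have he' := exp_neg_mul_exp φ
    simp only [coherentVector, hm, hm', he]
    push_cast at h1 ⊢
    linear_combination (Complex.cos (θ / 2)) ^ (m + 1) * Complex.sin (θ / 2) ^ (a + 1) *
      Complex.exp (Complex.I * a * φ) *
      (((ladderCoeff N a : ℂ) * (√(N.choose (a + 1)) : ℂ)) * he' + h1)
  · have : ¬ a + 1 < N + 1 := h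
    obtain rfl : a = N := by omega
    simp

theorem sin_mul_spinLower_coherentVector (N : ℕ) (θ φ : ℝ) (a : Fin (N + 1)) :
    (Real.sin (θ / 2) : ℂ) * Complex.exp (Complex.I * φ) *
        (spinLower N *ᵥ coherentVector N θ φ) a =
      (Real.cos (θ / 2) : ℂ) * (a : ℕ) * coherentVector N θ φ a := by
  obtain ⟨a, ha⟩ := a
  rw [spinLower_mulVec]
  rcases a with _ | a
  · simp
  · have h1 := congrArg (fun r : ℝ => (r : ℂ)) (sqrt_choose_pred (show a < N by omega))
    obtain ⟨m, hm⟩ : ∃ m, N - a = m + 1 := ⟨N - a - 1, by omega⟩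
    have hm' : N - (a + 1) = m := by omega
    have he : Complex.exp (Complex.I * ((a + 1 : ℕ) : ℂ) * φ) =
        Complex.exp (Complex.I * a * φ) * Complex.exp (Complex.I * φ) := by
      rw [← Complex.exp_add]; congr 1; push_cast; ring
    rw [if_neg (by simp)]
    simp only [coherentVector, Nat.add_sub_cancel, hm, hm', he]
    push_cast at h1 ⊢
    linear_combination (Complex.cos (θ / 2)) ^ (m + 1) * Complex.sin (θ / 2) ^ (a + 1) *
      Complex.exp (Complex.I * a * φ) * Complex.exp (Complex.I * φ) * h1

/-- The three terms are sc times N - a, -a and -(N - 2a), which cancel. -/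
theorem rotRaise_mulVec_coherentVector (N : ℕ) (θ φ : ℝ) :
    rotRaise N θ φ *ᵥ coherentVector N θ φ = 0 := by
  ext a
  have h1 := cos_mul_spinRaise_coherentVector N θ φ a
  have h2 := sin_mul_spinLower_coherentVector N θ φ a
  simp only [rotRaise, Matrix.sub_mulVec, Matrix.smul_mulVec, Pi.sub_apply, Pi.smul_apply,
    spinAxis_mulVec, smul_eq_mul, Pi.zero_apply]
  linear_combination (Real.cos (θ / 2) : ℂ) * h1 - (Real.sin (θ / 2) : ℂ) * h2

theorem rotAxis_mulVec_coherentVector (N : ℕ) (θ φ : ℝ) :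
    rotAxis N θ φ *ᵥ coherentVector N θ φ = ((N : ℂ) / 2) • coherentVector N θ φ := by
  ext a
  have h1 := cos_mul_spinRaise_coherentVector N θ φ a
  have h2 := sin_mul_spinLower_coherentVector N θ φ a
  have hc := half_angle θ
  simp only [rotAxis, Matrix.add_mulVec, Matrix.smul_mulVec, Pi.add_apply, Pi.smul_apply,
    spinAxis_mulVec, smul_eq_mul]
  linear_combination (Real.sin (θ / 2) : ℂ) * h1 + (Real.cos (θ / 2) : ℂ) * h2 +
    (N : ℂ) / 2 * coherentVector N θ φ a * hc

/-! ### The highest weight module -/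

theorem axis_mulVec_pow {ι : Type*} [Fintype ι] [DecidableEq ι] {B C : Matrix ι ι ℂ} {v : ι → ℂ}
    {μ : ℂ} (hCB : C * B = B * C - B) (hC : C *ᵥ v = μ • v) (a : ℕ) :
    C *ᵥ (B ^ a *ᵥ v) = (μ - a) • (B ^ a *ᵥ v) := by
  induction a with
  | zero => simp [hC]
  | succ a ih =>
    rw [pow_succ', ← Matrix.mulVec_mulVec, Matrix.mulVec_mulVec (B ^ a *ᵥ v) C B, hCB,
      Matrix.sub_mulVec, ← Matrix.mulVec_mulVec, ih, Matrix.mulVec_smul]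
    push_cast
    module

/-- The standard 𝔰𝔩₂ computation: each commutation of A past a B contributes twice the weight μ - b
of the vector reached, and the sum of 2(μ - b) over b ≤ a is (a + 1)(2μ - a). -/
theorem raise_mulVec_pow {ι : Type*} [Fintype ι] [DecidableEq ι] {A B C : Matrix ι ι ℂ}
    {v : ι → ℂ} {μ : ℂ} (hAB : A * B = B * A + (2 : ℂ) • C) (hCB : C * B = B * C - B)
    (hA : A *ᵥ v = 0) (hC : C *ᵥ v = μ • v) (a : ℕ) :
    A *ᵥ (B ^ (a + 1) *ᵥ v) = (((a : ℂ) + 1) * (2 * μ - a)) • (B ^ a *ᵥ v) := by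
  have step : ∀ a : ℕ, A *ᵥ (B ^ (a + 1) *ᵥ v) =
      B *ᵥ (A *ᵥ (B ^ a *ᵥ v)) + (2 * (μ - a)) • (B ^ a *ᵥ v) := fun a => by
    rw [pow_succ', ← Matrix.mulVec_mulVec, Matrix.mulVec_mulVec (B ^ a *ᵥ v) A B, hAB,
      Matrix.add_mulVec, ← Matrix.mulVec_mulVec, Matrix.smul_mulVec, axis_mulVec_pow hCB hC,
      smul_smul]
  induction a with
  | zero => rw [step]; simp [hA]
  | succ a ih =>
    rw [step, ih, Matrix.mulVec_smul, Matrix.mulVec_mulVec, ← pow_succ']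
    push_cast
    module

theorem rotRaise_mulVec_pow (N : ℕ) (θ φ : ℝ) (a : ℕ) :
    rotRaise N θ φ *ᵥ (rotLower N θ φ ^ (a + 1) *ᵥ coherentVector N θ φ) =
      (((a : ℂ) + 1) * ((N : ℂ) - a)) • (rotLower N θ φ ^ a *ᵥ coherentVector N θ φ) := by
  rw [raise_mulVec_pow (rotRaise_mul_rotLower N θ φ) (rotAxis_mul_rotLower N θ φ)
    (rotRaise_mulVec_coherentVector N θ φ) (rotAxis_mulVec_coherentVector N θ φ)]
  congr 2
  ring

theorem star_rotLower_mulVec_dotProduct (N : ℕ) (θ φ : ℝ) (f g : Fin (N + 1) → ℂ) :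
    star (rotLower N θ φ *ᵥ f) ⬝ᵥ g = star f ⬝ᵥ (rotRaise N θ φ *ᵥ g) := by
  rw [Matrix.star_mulVec, ← Matrix.dotProduct_mulVec, ← conjTranspose_rotRaise,
    Matrix.conjTranspose_conjTranspose]

/-- The squared norm of this vector is ⟨B^N v, A B^{N+1} v⟩, and A B^{N+1} v carries the factor N -
N = 0. -/
theorem rotLower_pow_succ_mulVec (N : ℕ) (θ φ : ℝ) :
    rotLower N θ φ ^ (N + 1) *ᵥ coherentVector N θ φ = 0 := by
  have h := rotRaise_mulVec_pow N θ φ N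
  rw [sub_self, mul_zero, zero_smul] at h
  open scoped ComplexOrder in rw [← dotProduct_star_self_eq_zero (R := ℂ)]
  conv_lhs => arg 1; rw [pow_succ', ← Matrix.mulVec_mulVec]
  rw [star_rotLower_mulVec_dotProduct, h, dotProduct_zero]

/-! ### The rotation matrix and its intertwining relations -/

/-- The normalization of `(S⁻)^a |J⟩`. -/
def ladderNorm (N a : ℕ) : ℂ := ((∏ b ∈ Finset.range a, ladderCoeff N b : ℝ) : ℂ)⁻¹

theorem ladderCoeff_mul_ladderNorm {N a : ℕ} (h : a < N) :
    (ladderCoeff N a : ℂ) * ladderNorm N (a + 1) = ladderNorm N a := by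
  have : (ladderCoeff N a : ℂ) ≠ 0 := by exact_mod_cast (ladderCoeff_pos h).ne'
  rw [ladderNorm, ladderNorm, Finset.prod_range_succ]
  push_cast
  rw [mul_inv, mul_comm, mul_assoc, inv_mul_cancel₀ this, mul_one]

/-- The rotation of the spin that takes `|J⟩` to the coherent vector: its columns are the
normalized vectors obtained from the coherent vector by lowering. -/
def rotMatrix (N : ℕ) (θ φ : ℝ) : Matrix (Fin (N + 1)) (Fin (N + 1)) ℂ :=
  Matrix.of fun b a =>
    ladderNorm N a * (rotLower N θ φ ^ (a : ℕ) *ᵥ coherentVector N θ φ) b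

theorem rotMatrix_zero (N : ℕ) (θ φ : ℝ) (b : Fin (N + 1)) :
    rotMatrix N θ φ b 0 = coherentVector N θ φ b := by
  simp [rotMatrix, ladderNorm]

theorem mul_rotMatrix_apply (N : ℕ) (θ φ : ℝ) (A : Matrix (Fin (N + 1)) (Fin (N + 1)) ℂ)
    (b a : Fin (N + 1)) : (A * rotMatrix N θ φ) b a =
      ladderNorm N a * (A *ᵥ (rotLower N θ φ ^ (a : ℕ) *ᵥ coherentVector N θ φ)) b := by
  simp only [Matrix.mul_apply, rotMatrix, Matrix.of_apply]
  rw [Matrix.mulVec, dotProduct, Finset.mul_sum]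
  exact Finset.sum_congr rfl fun c _ => by ring

theorem rotAxis_mul_rotMatrix (N : ℕ) (θ φ : ℝ) :
    rotAxis N θ φ * rotMatrix N θ φ = rotMatrix N θ φ * spinAxis N := by
  ext b a
  rw [mul_rotMatrix_apply, axis_mulVec_pow (rotAxis_mul_rotLower N θ φ)
    (rotAxis_mulVec_coherentVector N θ φ), spinAxis, Matrix.mul_diagonal]
  simp [rotMatrix, magneticNumber]
  ring

/-- Lowering moves one column to the next, and the normalizations of consecutive columns differ by
the matrix element of S⁻. The last column is killed by `rotLower_pow_succ_mulVec`, matching the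
cutoff of `spinLower`. -/
theorem rotLower_mul_rotMatrix (N : ℕ) (θ φ : ℝ) :
    rotLower N θ φ * rotMatrix N θ φ = rotMatrix N θ φ * spinLower N := by
  ext b ⟨a, ha⟩
  rw [mul_rotMatrix_apply, Matrix.mulVec_mulVec, ← pow_succ', Matrix.mul_apply]
  simp only [spinLower_apply, mul_ite, mul_zero]
  rw [sum_fin_eq_succ a fun c => rotMatrix N θ φ b c * (ladderCoeff N a : ℂ)]
  split_ifs with h
  · rw [← ladderCoeff_mul_ladderNorm (show a < N by omega)]
    simp [rotMatrix]
    ring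
  · obtain rfl : a = N := by omega
    simp [rotLower_pow_succ_mulVec]

theorem rotRaise_mul_rotMatrix (N : ℕ) (θ φ : ℝ) :
    rotRaise N θ φ * rotMatrix N θ φ = rotMatrix N θ φ * spinRaise N := by
  ext b ⟨a, ha⟩
  rw [mul_rotMatrix_apply, Matrix.mul_apply]
  simp only [spinRaise_apply, mul_ite, mul_zero]
  rw [sum_fin_succ_eq ⟨a, ha⟩ fun c => rotMatrix N θ φ b c * (ladderCoeff N c : ℂ)]
  rcases a with _ | a
  · simp [rotRaise_mulVec_coherentVector]
  · have h1 := ladderCoeff_mul_ladderNorm (show a < N by omega)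
    have h2 := congrArg (fun r : ℝ => (r : ℂ)) (ladderCoeff_sq (show a ≤ N by omega))
    rw [if_neg (by simp)]
    simp only [rotRaise_mulVec_pow, rotMatrix, Matrix.of_apply, Nat.add_sub_cancel, Pi.smul_apply,
      smul_eq_mul]
    push_cast at h2
    rw [← h1, ← h2]
    ring

/-- The lowered vectors are orthogonal to the coherent vector because the adjoint of the lowering
operator annihilates it. Full unitarity is not needed: the rotation is only ever paired with the
image of the all-|J⟩ vector, which sees column 0 alone. -/
theorem conjTranspose_rotMatrix_mul_zero (N : ℕ) (θ φ : ℝ) (a : Fin (N + 1)) :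
    ((rotMatrix N θ φ)ᴴ * rotMatrix N θ φ) a 0 = if a = 0 then 1 else 0 := by
  have h : ((rotMatrix N θ φ)ᴴ * rotMatrix N θ φ) a 0 = star (ladderNorm N a) *
      (star (rotLower N θ φ ^ (a : ℕ) *ᵥ coherentVector N θ φ) ⬝ᵥ coherentVector N θ φ) := by
    simp only [Matrix.mul_apply, Matrix.conjTranspose_apply, rotMatrix_zero, dotProduct,
      Finset.mul_sum, Pi.star_apply]
    exact Finset.sum_congr rfl fun c _ => by rw [rotMatrix, Matrix.of_apply, star_mul', mul_assoc]
  rw [h]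
  obtain ⟨a, ha⟩ := a
  rcases a with _ | a
  · have := siteExpectation_one N θ φ
    rw [siteExpectation, Matrix.one_mulVec] at this
    simp [ladderNorm, this]
  · simp only
    rw [pow_succ', ← Matrix.mulVec_mulVec, star_rotLower_mulVec_dotProduct,
      rotRaise_mulVec_coherentVector, dotProduct_zero, mul_zero, if_neg]
    simp

/-! ### Components of the spin -/

/-- The component of `w` in the direction `(θ, φ)`. -/
def radialCoord (θ φ : ℝ) (w : EuclideanSpace ℝ (Fin 3)) : ℝ :=
  Real.sin θ * Real.cos φ * w 0 + Real.sin θ * Real.sin φ * w 1 + Real.cos θ * w 2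

/-- The matrix `w · S` for the vector `w` with `w₁ + i w₂ = z` and `w₃ = r`. -/
def spinComponent (N : ℕ) (z : ℂ) (r : ℝ) : Matrix (Fin (N + 1)) (Fin (N + 1)) ℂ :=
  ((starRingEnd ℂ) z / 2) • spinRaise N + (z / 2) • spinLower N + (r : ℂ) • spinAxis N

theorem tangentCoord_eq (θ φ : ℝ) (w : EuclideanSpace ℝ (Fin 3)) :
    tangentCoord θ φ w =
      ((Real.cos θ * Real.cos φ * w 0 + Real.cos θ * Real.sin φ * w 1 - Real.sin θ * w 2 : ℝ) : ℂ) +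
        Complex.I * ((-Real.sin φ * w 0 + Real.cos φ * w 1 : ℝ) : ℂ) := by
  rw [tangentCoord]
  congr 3
  · simp [tangentBasis₁, PiLp.inner_apply, Fin.sum_univ_three]; ring
  · simp [tangentBasis₂, PiLp.inner_apply, Fin.sum_univ_three]; ring

/-- Pythagoras in the rotated orthonormal frame. It bounds both components by ‖w‖ with constant 1,
as the sharp form of the error bound requires. -/
theorem norm_sq_tangentCoord_add (θ φ : ℝ) (w : EuclideanSpace ℝ (Fin 3)) :
    ‖tangentCoord θ φ w‖ ^ 2 + radialCoord θ φ w ^ 2 = ‖w‖ ^ 2 := by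
  have h1 := Real.sin_sq_add_cos_sq θ
  have h2 := Real.sin_sq_add_cos_sq φ
  rw [tangentCoord_eq, mul_comm Complex.I, Complex.sq_norm, Complex.normSq_add_mul_I, radialCoord,
    EuclideanSpace.norm_sq_eq, Fin.sum_univ_three]
  simp only [Real.norm_eq_abs, sq_abs]
  grind

theorem norm_tangentCoord_le_norm (θ φ : ℝ) (w : EuclideanSpace ℝ (Fin 3)) :
    ‖tangentCoord θ φ w‖ ≤ ‖w‖ := by
  refine abs_le_of_sq_le_sq' ?_ (norm_nonneg _) |>.2
  have := norm_sq_tangentCoord_add θ φ w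
  have := sq_nonneg (radialCoord θ φ w)
  linarith

theorem abs_radialCoord_le_norm (θ φ : ℝ) (w : EuclideanSpace ℝ (Fin 3)) :
    |radialCoord θ φ w| ≤ ‖w‖ := by
  refine abs_le_of_sq_le_sq ?_ (norm_nonneg _)
  have := norm_sq_tangentCoord_add θ φ w
  have := sq_nonneg ‖tangentCoord θ φ w‖
  linarith

theorem summable_norm_tangentCoord {L : Type*} (θ φ : L → ℝ) (v : SummableField L) :
    Summable fun x => ‖tangentCoord (θ x) (φ x) (v x)‖ :=
  Summable.of_nonneg_of_le (fun _ => norm_nonneg _)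
    (fun x => norm_tangentCoord_le_norm (θ x) (φ x) (v x))
    (by simpa using (lp.memℓp v).summable (by simp))

theorem summable_abs_radialCoord {L : Type*} (θ φ : L → ℝ) (v : SummableField L) :
    Summable fun x => |radialCoord (θ x) (φ x) (v x)| :=
  Summable.of_nonneg_of_le (fun _ => abs_nonneg _)
    (fun x => abs_radialCoord_le_norm (θ x) (φ x) (v x))
    (by simpa using (lp.memℓp v).summable (by simp))

/-- The rotated matrices are the spin components along the frame f¹, f² and the direction (θ, φ), so
this expands w in that frame, with the tangential pair written through raising and lowering. -/
theorem sum_smul_spinMatrix (N : ℕ) (θ φ : ℝ) (w : EuclideanSpace ℝ (Fin 3)) :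
    ∑ i, (w i : ℂ) • spinMatrix N i =
      ((starRingEnd ℂ) (tangentCoord θ φ w) / 2) • rotRaise N θ φ +
        (tangentCoord θ φ w / 2) • rotLower N θ φ + (radialCoord θ φ w : ℂ) • rotAxis N θ φ := by
  have hθc : Real.cos θ = Real.cos (θ / 2) ^ 2 - Real.sin (θ / 2) ^ 2 := by
    rw [← Real.cos_two_mul', mul_div_cancel₀ _ two_ne_zero]
  have hθs : Real.sin θ = 2 * Real.sin (θ / 2) * Real.cos (θ / 2) := by
    rw [← Real.sin_two_mul, mul_div_cancel₀ _ two_ne_zero]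
  have hc := Real.sin_sq_add_cos_sq (θ / 2)
  have hp := Real.sin_sq_add_cos_sq φ
  have he : Complex.exp (Complex.I * φ) = (Real.cos φ : ℂ) + Complex.I * (Real.sin φ : ℂ) := by
    rw [mul_comm, Complex.exp_mul_I]; push_cast; ring
  have he' : Complex.exp (-(Complex.I * φ)) =
      (Real.cos φ : ℂ) - Complex.I * (Real.sin φ : ℂ) := by
    have : -(Complex.I * φ) = ((-φ : ℝ) : ℂ) * Complex.I := by push_cast; ring
    rw [this, Complex.exp_mul_I, ← Complex.ofReal_cos, ← Complex.ofReal_sin, Real.cos_neg,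
      Real.sin_neg]
    push_cast; ring
  have hS : (Matrix.diagonal fun a => (magneticNumber N a : ℂ)) = spinAxis N := rfl
  replace hc := congrArg (fun r : ℝ => (r : ℂ)) hc
  replace hp := congrArg (fun r : ℝ => (r : ℂ)) hp
  have hI := Complex.I_sq
  have hI' : (1 : ℂ) / (2 * Complex.I) = -Complex.I / 2 := by
    field_simp; simp
  simp only [Fin.sum_univ_three, spinMatrix, Matrix.cons_val_zero, Matrix.cons_val_one,
    Matrix.cons_val, rotRaise, rotLower, rotAxis, radialCoord, tangentCoord_eq, hθc, hθs, he, he',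
    map_add, map_mul, Complex.conj_I, Complex.conj_ofReal, hI', hS]
  push_cast at hc hp ⊢
  -- From here only polynomial relations matter: c² + s² = 1, p² + q² = 1 and I² = -1.
  generalize Complex.cos (θ / 2) = c at *
  generalize Complex.sin (θ / 2) = s at *
  generalize Complex.cos φ = p at *
  generalize Complex.sin φ = q at *
  generalize Complex.I = I at *
  match_scalars
  · grind
  · grind
  · grind

theorem sum_smul_spinMatrix_mul_rotMatrix (N : ℕ) (θ φ : ℝ) (w : EuclideanSpace ℝ (Fin 3)) :
    (∑ i, (w i : ℂ) • spinMatrix N i) * rotMatrix N θ φ =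
      rotMatrix N θ φ * spinComponent N (tangentCoord θ φ w) (radialCoord θ φ w) := by
  rw [sum_smul_spinMatrix N θ φ, spinComponent]
  simp only [add_mul, mul_add, Matrix.smul_mul, Matrix.mul_smul, rotRaise_mul_rotMatrix,
    rotLower_mul_rotMatrix, rotAxis_mul_rotMatrix]

section Rotation

variable {L : Type*} [DecidableEq L]

/-! ### Rotation of finitely many sites -/

theorem siteOp_add {N : ℕ} (x : L) (A B : Matrix (Fin (N + 1)) (Fin (N + 1)) ℂ) :
    siteOp x (A + B) = siteOp x A + siteOp x B := by
  ext ψ σ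
  simp [siteOp_apply, add_mul, Finset.sum_add_distrib]

theorem siteOp_smul {N : ℕ} (x : L) (c : ℂ) (A : Matrix (Fin (N + 1)) (Fin (N + 1)) ℂ) :
    siteOp x (c • A) = c • siteOp x A := by
  ext ψ σ
  simp [siteOp_apply, Finset.mul_sum, mul_assoc]

theorem siteOp_sum {N : ℕ} (x : L) {ι : Type*} (s : Finset ι)
    (A : ι → Matrix (Fin (N + 1)) (Fin (N + 1)) ℂ) :
    siteOp x (∑ i ∈ s, A i) = ∑ i ∈ s, siteOp x (A i) :=
  map_sum (AddMonoidHom.mk' (siteOp x) (siteOp_add x)) A s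

/-- Outside Λ the product vector is supported on the value 0, so only column 0 of A is seen.
Matrices with the same column 0, such as `rotMatrix` and `raiseMatrix`, therefore act alike. -/
theorem siteOp_apply_productVector (N : ℕ) (θ φ : L → ℝ) (Λ : Finset L) {y : L} (hy : y ∉ Λ)
    (A : Matrix (Fin (N + 1)) (Fin (N + 1)) ℂ) (σ : L → Fin (N + 1)) :
    siteOp y A (productVector N θ φ Λ) σ =
      A (σ y) 0 * productVector N θ φ Λ (Function.update σ y 0) := by
  rw [siteOp_apply, Finset.sum_eq_single 0]
  · intro m _ hm
    rw [productVector_apply, if_neg, mul_zero]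
    intro h
    exact hm (by simpa using h y hy)
  · simp

theorem siteOp_rotMatrix_productVector (N : ℕ) (θ φ : L → ℝ) (Λ : Finset L) {y : L} (hy : y ∉ Λ) :
    siteOp y (rotMatrix N (θ y) (φ y)) (productVector N θ φ Λ) =
      productVector N θ φ (insert y Λ) := by
  rw [← siteOp_raise N θ φ Λ hy]
  refine lp.ext (funext fun σ => ?_)
  rw [siteOp_apply_productVector _ _ _ _ hy, siteOp_apply_productVector _ _ _ _ hy, rotMatrix_zero]
  simp [raiseMatrix]

/-- The product of the rotations at the sites in a list. -/
def rotOp (N : ℕ) (θ φ : L → ℝ) (l : List L) : ConfigSpace L N →L[ℂ] ConfigSpace L N :=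
  (l.map fun x => siteOp x (rotMatrix N (θ x) (φ x))).prod

theorem rotOp_cons (N : ℕ) (θ φ : L → ℝ) (y : L) (l : List L) :
    rotOp N θ φ (y :: l) = siteOp y (rotMatrix N (θ y) (φ y)) * rotOp N θ φ l := by
  simp [rotOp]

theorem siteOp_commute_rotOp (N : ℕ) (θ φ : L → ℝ) {y : L} {l : List L} (hy : y ∉ l)
    (A : Matrix (Fin (N + 1)) (Fin (N + 1)) ℂ) : Commute (siteOp y A) (rotOp N θ φ l) := by
  refine Commute.list_prod_right _ _ fun T hT => ?_
  obtain ⟨x, hx, rfl⟩ := List.mem_map.1 hT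
  exact siteOp_commute (ne_of_mem_of_not_mem hx hy).symm _ _

theorem siteOp_mul_rotOp (N : ℕ) (θ φ : L → ℝ) {x : L} {l : List L} (hl : l.Nodup) (hx : x ∈ l)
    {A B : Matrix (Fin (N + 1)) (Fin (N + 1)) ℂ}
    (h : A * rotMatrix N (θ x) (φ x) = rotMatrix N (θ x) (φ x) * B) :
    siteOp x A * rotOp N θ φ l = rotOp N θ φ l * siteOp x B := by
  induction l with
  | nil => simp at hx
  | cons y l ih =>
    rw [List.nodup_cons] at hl
    rw [rotOp_cons]
    by_cases hxy : x = y
    · subst hxy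
      rw [← mul_assoc, ← siteOp_mul, h, siteOp_mul, mul_assoc, mul_assoc,
        (siteOp_commute_rotOp N θ φ hl.1 B).eq]
    · rw [← mul_assoc, (siteOp_commute hxy _ _).eq, mul_assoc, mul_assoc,
        ih hl.2 (by simpa [hxy] using hx)]

theorem rotOp_productVector (N : ℕ) (θ φ : L → ℝ) {l : List L} (hl : l.Nodup) :
    rotOp N θ φ l (productVector N θ φ ∅) = productVector N θ φ l.toFinset := by
  induction l with
  | nil => simp [rotOp]
  | cons y l ih =>
    rw [List.nodup_cons] at hl
    rw [rotOp_cons, mul_apply_eq_comp, ih hl.2, List.toFinset_cons,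
      siteOp_rotMatrix_productVector _ _ _ _ (by simpa using hl.1)]

theorem siteOp_conjTranspose_rotMatrix_mul (N : ℕ) (θ φ : L → ℝ) (y : L) :
    siteOp y ((rotMatrix N (θ y) (φ y))ᴴ * rotMatrix N (θ y) (φ y)) (productVector N θ φ ∅) =
      productVector N θ φ ∅ := by
  refine lp.ext (funext fun σ => ?_)
  rw [siteOp_apply_productVector _ _ _ _ (Finset.notMem_empty y), conjTranspose_rotMatrix_mul_zero]
  split_ifs with h
  · rw [← h, Function.update_eq_self, one_mul]
  · rw [zero_mul, productVector_apply, if_neg]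
    exact fun h' => h (h' y (Finset.notMem_empty y))

/-- Each U_y*U_y is moved to the left entry, commuted past the rotations at the other sites, and
absorbed by the all-|J⟩ vector. The right entry χ is arbitrary. -/
theorem inner_rotOp (N : ℕ) (θ φ : L → ℝ) {l : List L} (hl : l.Nodup) (χ : ConfigSpace L N) :
    ⟪rotOp N θ φ l (productVector N θ φ ∅), rotOp N θ φ l χ⟫_ℂ =
      ⟪productVector N θ φ ∅, χ⟫_ℂ := by
  induction l with
  | nil => simp [rotOp]
  | cons y l ih =>
    rw [List.nodup_cons] at hl
    have h : siteOp y (rotMatrix N (θ y) (φ y))ᴴ (siteOp y (rotMatrix N (θ y) (φ y))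
        (rotOp N θ φ l (productVector N θ φ ∅))) = rotOp N θ φ l (productVector N θ φ ∅) := by
      rw [← mul_apply_eq_comp, ← siteOp_mul, ← mul_apply_eq_comp,
        (siteOp_commute_rotOp N θ φ hl.1 _).eq, mul_apply_eq_comp,
        siteOp_conjTranspose_rotMatrix_mul]
    rw [rotOp_cons, mul_apply_eq_comp, mul_apply_eq_comp, ← ContinuousLinearMap.adjoint_inner_left,
      ← ContinuousLinearMap.star_eq_adjoint, siteOp_star, h, ih hl.2]

theorem inner_productVector_empty (N : ℕ) (θ φ : L → ℝ) (χ : ConfigSpace L N) :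
    ⟪productVector N θ φ ∅, χ⟫_ℂ = χ 0 := by
  rw [lp.inner_eq_tsum, tsum_eq_single 0]
  · simp [productVector_apply]
  · intro σ hσ
    rw [productVector_apply, if_neg, inner_zero_left]
    exact fun h => hσ (funext fun y => h y (Finset.notMem_empty y))

/-- Rotating the sites of Λ replaces every A by B and the product vector over Λ by the fixed all-|J⟩
vector. Afterwards Λ enters only as the range of the sums, so the limit in Λ can be taken. -/
theorem productExpectation_prod_eq (N : ℕ) (θ φ : L → ℝ) {ι : Type*} (Λ : Finset L) (c : ℂ)
    (A B : ι → L → Matrix (Fin (N + 1)) (Fin (N + 1)) ℂ)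
    (h : ∀ j x, A j x * rotMatrix N (θ x) (φ x) = rotMatrix N (θ x) (φ x) * B j x) (js : List ι) :
    productExpectation N θ φ Λ (js.map fun j => c • ∑ x ∈ Λ, siteOp x (A j x)).prod =
      (js.map fun j => c • ∑ x ∈ Λ, siteOp x (B j x)).prod (productVector N θ φ ∅) 0 := by
  have hl := Λ.nodup_toList
  have hcomm : (js.map fun j => c • ∑ x ∈ Λ, siteOp x (A j x)).prod * rotOp N θ φ Λ.toList =
      rotOp N θ φ Λ.toList * (js.map fun j => c • ∑ x ∈ Λ, siteOp x (B j x)).prod := by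
    induction js with
    | nil => simp
    | cons j js ih =>
      have hj : (c • ∑ x ∈ Λ, siteOp x (A j x)) * rotOp N θ φ Λ.toList =
          rotOp N θ φ Λ.toList * (c • ∑ x ∈ Λ, siteOp x (B j x)) := by
        rw [smul_mul_assoc, mul_smul_comm, Finset.sum_mul, Finset.mul_sum]
        congr 1
        exact Finset.sum_congr rfl fun x hx =>
          siteOp_mul_rotOp N θ φ hl (Finset.mem_toList.2 hx) (h j x)
      rw [List.map_cons, List.prod_cons, List.map_cons, List.prod_cons, mul_assoc, ih, ← mul_assoc,
        hj, mul_assoc]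
  have hv := rotOp_productVector N θ φ hl
  rw [Finset.toList_toFinset] at hv
  rw [productExpectation, ← hv, ← mul_apply_eq_comp, hcomm, mul_apply_eq_comp, inner_rotOp _ _ _ hl,
    inner_productVector_empty]

/-- A diagonal limit: the sums and the vector defining the state are truncated to the same Λ.
Product expectations are contractions, so norm convergence of the truncated products makes the
truncation error vanish uniformly over the states. -/
theorem coherentState_eq_of_intertwine (N : ℕ) (θ φ : L → ℝ) {ι : Type*} (c : ℂ)
    (A B : ι → L → Matrix (Fin (N + 1)) (Fin (N + 1)) ℂ)
    (h : ∀ j x, A j x * rotMatrix N (θ x) (φ x) = rotMatrix N (θ x) (φ x) * B j x)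
    (hA : ∀ j, Summable fun x => siteOp x (A j x)) (hB : ∀ j, Summable fun x => siteOp x (B j x))
    (js : List ι) (T : quasiLocalAlgebra L N)
    (hT : (T : ConfigSpace L N →L[ℂ] ConfigSpace L N) =
      (js.map fun j => c • ∑' x, siteOp x (A j x)).prod) :
    coherentState N θ φ T =
      (js.map fun j => c • ∑' x, siteOp x (B j x)).prod (productVector N θ φ ∅) 0 := by
  have tA : Tendsto (fun Λ : Finset L => (js.map fun j => c • ∑ x ∈ Λ, siteOp x (A j x)).prod) atTop
      (𝓝 (js.map fun j => c • ∑' x, siteOp x (A j x)).prod) :=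
    tendsto_list_prod js fun j _ => Tendsto.const_smul (hA j).hasSum c
  have tB : Tendsto (fun Λ : Finset L => (js.map fun j => c • ∑ x ∈ Λ, siteOp x (B j x)).prod) atTop
      (𝓝 (js.map fun j => c • ∑' x, siteOp x (B j x)).prod) :=
    tendsto_list_prod js fun j _ => Tendsto.const_smul (hB j).hasSum c
  have t1 := tendsto_productExpectation N θ φ T
  have t2 : Tendsto (fun Λ : Finset L => productExpectation N θ φ Λ
      ((js.map fun j => c • ∑ x ∈ Λ, siteOp x (A j x)).prod - T)) atTop (𝓝 0) := by
    rw [hT]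
    refine squeeze_zero_norm (fun Λ => norm_productExpectation_le N θ φ Λ _) ?_
    exact tendsto_iff_norm_sub_tendsto_zero.1 tA
  have t3 := t2.add t1
  have hadd : ∀ (Λ : Finset L) (S T : ConfigSpace L N →L[ℂ] ConfigSpace L N),
      productExpectation N θ φ Λ (S - T) + productExpectation N θ φ Λ T =
        productExpectation N θ φ Λ S := fun Λ S T => by simp [productExpectation]
  simp only [hadd, zero_add, productExpectation_prod_eq N θ φ _ c A B h js] at t3
  have hev : Continuous fun S : ConfigSpace L N →L[ℂ] ConfigSpace L N =>
      ⟪productVector N θ φ ∅, S (productVector N θ φ ∅)⟫_ℂ := by fun_prop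
  have t4 := (hev.tendsto _).comp tB
  simp only [inner_productVector_empty, Function.comp_def] at t4
  exact tendsto_nhds_unique t3 t4

/-! ### Fluctuation operators in the rotated frame -/

/-- The matrix `w · S - J r` for the vector `w` with `w₁ + i w₂ = z` and `w₃ = r`. -/
def centeredComponent (N : ℕ) (z : ℂ) (r : ℝ) : Matrix (Fin (N + 1)) (Fin (N + 1)) ℂ :=
  spinComponent N z r - ((r * (N / 2) : ℝ) : ℂ) • 1

theorem spinDot_coe (N : ℕ) (x : L) (w : EuclideanSpace ℝ (Fin 3)) :
    (spinDot N x w : ConfigSpace L N →L[ℂ] ConfigSpace L N) =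
      siteOp x (∑ i, (w i : ℂ) • spinMatrix N i) := by
  rw [siteOp_sum, spinDot, ← StarSubalgebra.subtype_apply, map_sum]
  refine Finset.sum_congr rfl fun i _ => ?_
  rw [map_smul, siteOp_smul]
  rfl

theorem siteExpectation_sum_smul_spinMatrix (N : ℕ) (θ φ : ℝ) (w : EuclideanSpace ℝ (Fin 3)) :
    siteExpectation N θ φ (∑ i, (w i : ℂ) • spinMatrix N i) =
      ((radialCoord θ φ w * (N / 2) : ℝ) : ℂ) := by
  -- The expectation of the lowering part is the conjugate of that of the raising part, which
  -- vanishes.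
  have h2 : star (coherentVector N θ φ) ⬝ᵥ (rotLower N θ φ *ᵥ coherentVector N θ φ) = 0 := by
    have := star_rotLower_mulVec_dotProduct N θ φ (coherentVector N θ φ) (coherentVector N θ φ)
    rw [rotRaise_mulVec_coherentVector, dotProduct_zero] at this
    have h := congrArg star this
    rw [← Matrix.star_dotProduct_star, star_star, star_zero] at h
    exact h
  have h1 := siteExpectation_one N θ φ
  rw [siteExpectation, Matrix.one_mulVec] at h1
  rw [siteExpectation, sum_smul_spinMatrix N θ φ]
  simp only [Matrix.add_mulVec, Matrix.smul_mulVec, rotRaise_mulVec_coherentVector,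
    rotAxis_mulVec_coherentVector, dotProduct_add, dotProduct_smul, h1, h2]
  simp

theorem coherentState_spinDot (N : ℕ) (θ φ : L → ℝ) (x : L) (w : EuclideanSpace ℝ (Fin 3)) :
    coherentState N θ φ (spinDot N x w) = ((radialCoord (θ x) (φ x) w * (N / 2) : ℝ) : ℂ) := by
  have h := coherentState_prod N θ φ (fun _ => ∑ i, (w i : ℂ) • spinMatrix N i) [x] (by simp)
  have h' : spinDot N x w = siteObs x (∑ i, (w i : ℂ) • spinMatrix N i) :=
    Subtype.ext (spinDot_coe N x w)
  simp only [List.map_cons, List.map_nil, List.prod_cons, List.prod_nil, mul_one] at h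
  rw [h', h, siteExpectation_sum_smul_spinMatrix]

theorem coe_centered_spinDot (N : ℕ) (θ φ : L → ℝ) (x : L) (w : EuclideanSpace ℝ (Fin 3)) :
    ((spinDot N x w - algebraMap ℂ (quasiLocalAlgebra L N)
      (coherentState N θ φ (spinDot N x w)) : quasiLocalAlgebra L N) :
        ConfigSpace L N →L[ℂ] ConfigSpace L N) =
      siteOp x (∑ i, (w i : ℂ) • spinMatrix N i -
        ((radialCoord (θ x) (φ x) w * (N / 2) : ℝ) : ℂ) • 1) := by
  rw [coherentState_spinDot, sub_eq_add_neg (∑ i, (w i : ℂ) • spinMatrix N i), ← neg_smul,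
    siteOp_add, siteOp_smul, siteOp_one, ← spinDot_coe, neg_smul, ← sub_eq_add_neg,
    Algebra.algebraMap_eq_smul_one]
  rfl

/-- The operator `√(2/J) ∑_x (w_x · S_x - J r_x)` for the family `w` with `w₁ + i w₂ = z` and
`w₃ = r`. -/
def framedFluctuation (N : ℕ) (z : L → ℂ) (r : L → ℝ) : ConfigSpace L N →L[ℂ] ConfigSpace L N :=
  ((√(2 / ((N : ℝ) / 2)) : ℝ) : ℂ) • ∑' x, siteOp x (centeredComponent N (z x) (r x))

/-- Each term combines four fixed matrices S⁺, S⁻, S³ and 1, whose placements have norm bounded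
independently of the site, with summable coefficients. -/
theorem summable_framedFluctuation (N : ℕ) {z : L → ℂ} {r : L → ℝ} (hz : Summable fun x => ‖z x‖)
    (hr : Summable fun x => |r x|) :
    Summable fun x => siteOp x (centeredComponent N (z x) (r x)) := by
  have key : ∀ (A : Matrix (Fin (N + 1)) (Fin (N + 1)) ℂ) (f : L → ℂ),
      (Summable fun x => ‖f x‖) → Summable fun x => f x • siteOp x A := fun A f hf =>
    Summable.of_norm_bounded (hf.mul_right (√(∑ a, ∑ m, ‖A a m‖ ^ 2) * (N + 1))) fun x => by
      rw [norm_smul]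
      gcongr
      exact norm_siteOp_le x A
  have h1 := key (spinRaise N) (fun x => (starRingEnd ℂ) (z x) / 2)
    (by simpa [norm_div] using hz.div_const 2)
  have h2 := key (spinLower N) (fun x => z x / 2) (by simpa [norm_div] using hz.div_const 2)
  have h3 := key (spinAxis N) (fun x => (r x : ℂ)) (by simpa using hr)
  have h4 := key 1 (fun x => -((r x * (N / 2) : ℝ) : ℂ))
    (by simpa [abs_mul] using hr.mul_right ((N : ℝ) / 2))
  refine (((h1.add h2).add h3).add h4).congr fun x => ?_
  rw [centeredComponent, spinComponent, sub_eq_add_neg, ← neg_smul]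
  simp only [siteOp_add, siteOp_smul]

/-- Expectations of products of fluctuation operators can be computed in the rotated frame, where
the coherent state is the vector state of `⨂ |J⟩`. -/
theorem coherentState_prod_fluctuation (N : ℕ) (θ φ : L → ℝ) (vs : List (SummableField L)) :
    coherentState N θ φ (vs.map fun v => fluctuation N θ φ v).prod =
      (vs.map fun v => framedFluctuation N (fun x => tangentCoord (θ x) (φ x) (v x))
        (fun x => radialCoord (θ x) (φ x) (v x))).prod (productVector N θ φ ∅) 0 := by
  have hs : ∀ v : SummableField L, HasSum (fun x => siteOp x (∑ i, (v x i : ℂ) • spinMatrix N i -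
      ((radialCoord (θ x) (φ x) (v x) * (N / 2) : ℝ) : ℂ) • 1))
      ((∑' x, (spinDot N x (v x) - algebraMap ℂ (quasiLocalAlgebra L N)
        (coherentState N θ φ (spinDot N x (v x)))) : quasiLocalAlgebra L N) :
          ConfigSpace L N →L[ℂ] ConfigSpace L N) := fun v => by
    have := (summable_fluctuation N θ φ v).hasSum.map
      (quasiLocalAlgebra L N).subtype continuous_subtype_val
    simpa only [Function.comp_def, StarSubalgebra.subtype_apply, coe_centered_spinDot] using this
  refine coherentState_eq_of_intertwine N θ φ ((√(2 / ((N : ℝ) / 2)) : ℝ) : ℂ)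
    (fun (v : SummableField L) x => ∑ i, (v x i : ℂ) • spinMatrix N i -
      ((radialCoord (θ x) (φ x) (v x) * (N / 2) : ℝ) : ℂ) • 1)
    (fun v x => centeredComponent N (tangentCoord (θ x) (φ x) (v x))
      (radialCoord (θ x) (φ x) (v x))) (fun v x => ?_) (fun v => (hs v).summable)
    (fun v => summable_framedFluctuation N (summable_norm_tangentCoord θ φ v)
      (summable_abs_radialCoord θ φ v)) vs _ ?_
  · rw [sub_mul, sum_smul_spinMatrix_mul_rotMatrix, centeredComponent, mul_sub, Matrix.smul_mul,
      Matrix.mul_smul, one_mul, mul_one]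
  · rw [← StarSubalgebra.subtype_apply, map_list_prod, List.map_map]
    congr 1
    refine List.map_congr_left fun v _ => ?_
    rw [(hs v).tsum_eq]
    rfl

end Rotation

section Ladder

variable {L : Type*}

/-! ### One-site ladder operators on Fock space -/

/-- A function dominated by the pull-back of an `ℓ²` function along an injection is in `ℓ²`. -/
theorem exists_lp_of_norm_le {ι κ : Type*} (ψ : lp (fun _ : ι => ℂ) 2) (f : κ → ℂ) (g : κ → ι)
    (S : Set κ) (hg : S.InjOn g) {C : ℝ} (hC : 0 ≤ C) (h0 : ∀ n ∉ S, f n = 0)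
    (h : ∀ n ∈ S, ‖f n‖ ≤ C * ‖ψ (g n)‖) :
    ∃ χ : lp (fun _ : κ => ℂ) 2, (∀ n, χ n = f n) ∧ ‖χ‖ ≤ C * ‖ψ‖ := by
  classical
  have key : ∀ s : Finset κ, ∑ n ∈ s, ‖f n‖ ^ 2 ≤ (C * ‖ψ‖) ^ 2 := fun s => by
    calc _ = ∑ n ∈ s.filter (· ∈ S), ‖f n‖ ^ 2 := by
          refine (Finset.sum_filter_of_ne fun n _ hn => ?_).symm
          by_contra hS
          exact hn (by simp [h0 n hS])
      _ ≤ ∑ n ∈ s.filter (· ∈ S), C ^ 2 * ‖ψ (g n)‖ ^ 2 := by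
          refine Finset.sum_le_sum fun n hn => ?_
          rw [← mul_pow]
          exact pow_le_pow_left₀ (norm_nonneg _) (h n (Finset.mem_filter.1 hn).2) 2
      _ = C ^ 2 * ∑ m ∈ (s.filter (· ∈ S)).image g, ‖ψ m‖ ^ 2 := by
          rw [← Finset.mul_sum, Finset.sum_image]
          exact hg.mono fun n hn => (Finset.mem_filter.1 hn).2
      _ ≤ C ^ 2 * ‖ψ‖ ^ 2 := by
          gcongr
          simpa using lp.sum_rpow_le_norm_rpow (p := 2) (by simp) ψ
            ((s.filter (· ∈ S)).image g)
      _ = _ := by ring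
  refine ⟨⟨f, memℓp_gen' (C := (C * ‖ψ‖) ^ 2) fun s => by simpa using key s⟩, fun _ => rfl, ?_⟩
  exact lp.norm_le_of_forall_sum_le (by simp) (by positivity) fun s => by simpa using key s

/-- Coordinates of `(z c(n) a^* + h.c.) + r d(n)` acting at the site `x`, where `c(n)` includes the
factor `√(n + 1)` of the creation operator. -/
def siteLadder (x : L) (z : ℂ) (r : ℝ) (c d : ℕ → ℝ) (ψ : (L →₀ ℕ) → ℂ) (n : L →₀ ℕ) : ℂ :=
  (if n x = 0 then 0 else z * c (n x - 1) * ψ (n - Finsupp.single x 1)) +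
    (starRingEnd ℂ) z * c (n x) * ψ (n + Finsupp.single x 1) + r * d (n x) * ψ n

theorem degree_sub_single {x : L} {n : L →₀ ℕ} (h : n x ≠ 0) :
    (n - Finsupp.single x 1).degree + 1 = n.degree := by
  have h2 := congrArg Finsupp.degree (Finsupp.sub_add_single_one_cancel h)
  rwa [map_add, Finsupp.degree_single] at h2

theorem degree_add_single (x : L) (n : L →₀ ℕ) :
    (n + Finsupp.single x 1).degree = n.degree + 1 := by
  rw [map_add, Finsupp.degree_single]

theorem siteLadder_eq_zero {K : ℕ} {ψ : (L →₀ ℕ) → ℂ} (hψ : ∀ n : L →₀ ℕ, K < n.degree → ψ n = 0)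
    (x : L) (z : ℂ) (r : ℝ) (c d : ℕ → ℝ) {n : L →₀ ℕ} (hn : K + 1 < n.degree) :
    siteLadder x z r c d ψ n = 0 := by
  have h1 : ψ (n + Finsupp.single x 1) = 0 := hψ _ (by rw [degree_add_single]; omega)
  rw [siteLadder, h1, hψ n (by omega)]
  split_ifs with h
  · simp
  · rw [hψ _ (by have := degree_sub_single h; omega)]
    simp

/-- The raising, lowering and diagonal parts each reindex ψ along an injection. Coefficient bounds
are needed only up to K, since a larger coefficient always multiplies a vanishing coordinate of ψ.
The raising and lowering parts give the factor 2C. -/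
theorem exists_siteLadder {K : ℕ} (ψ : Fock L) (hψ : ∀ n : L →₀ ℕ, K < n.degree → ψ n = 0)
    (x : L) (z : ℂ) (r : ℝ) {c d : ℕ → ℝ} {C D : ℝ} (hc : ∀ a ≤ K, |c a| ≤ C)
    (hd : ∀ a ≤ K, |d a| ≤ D) :
    ∃ χ : Fock L, (∀ n, χ n = siteLadder x z r c d ψ n) ∧
      ‖χ‖ ≤ (2 * C * ‖z‖ + D * |r|) * ‖ψ‖ := by
  have hC : 0 ≤ C := (abs_nonneg _).trans (hc 0 (Nat.zero_le K))
  have hD : 0 ≤ D := (abs_nonneg _).trans (hd 0 (Nat.zero_le K))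
  have bound : ∀ (w : ℂ) (t : ℝ) (B : ℝ) (m : L →₀ ℕ), (m.degree ≤ K → |t| ≤ B) →
      ‖w * t * ψ m‖ ≤ B * ‖w‖ * ‖ψ m‖ := fun w t B m h => by
    by_cases hm : m.degree ≤ K
    · rw [norm_mul, norm_mul, Complex.norm_real, Real.norm_eq_abs, mul_comm ‖w‖]
      gcongr
      exact h hm
    · rw [hψ m (by omega)]; simp
  obtain ⟨χ₁, h₁, n₁⟩ := exists_lp_of_norm_le ψ
    (fun n : L →₀ ℕ => if n x = 0 then 0 else z * c (n x - 1) * ψ (n - Finsupp.single x 1))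
    (fun n => n - Finsupp.single x 1) {n : L →₀ ℕ | n x ≠ 0}
    (fun n hn m hm h => by
      rw [← Finsupp.sub_add_single_one_cancel hn, ← Finsupp.sub_add_single_one_cancel hm]
      exact congrArg (· + Finsupp.single x 1) h)
    (C := C * ‖z‖) (by positivity) (fun n hn => if_pos (not_not.1 hn))
    (fun n hn => by
      rw [if_neg hn]
      refine bound _ _ _ _ fun h => hc _ ?_
      have h2 := Finsupp.le_degree x (n - Finsupp.single x 1)
      simp only [Finsupp.coe_tsub, Pi.sub_apply, Finsupp.single_eq_same] at h2
      omega)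
  obtain ⟨χ₂, h₂, n₂⟩ := exists_lp_of_norm_le ψ
    (fun n : L →₀ ℕ => (starRingEnd ℂ) z * c (n x) * ψ (n + Finsupp.single x 1))
    (fun n => n + Finsupp.single x 1) Set.univ
    (add_left_injective _).injOn (C := C * ‖z‖) (by positivity) (fun n hn => absurd trivial hn)
    (fun n _ => by
      rw [← RCLike.norm_conj z]
      refine bound _ _ _ _ fun h => hc _ ?_
      have h2 := Finsupp.le_degree x n
      rw [degree_add_single] at h
      omega)
  obtain ⟨χ₃, h₃, n₃⟩ := exists_lp_of_norm_le ψ (fun n : L →₀ ℕ => (r : ℂ) * d (n x) * ψ n) id Set.univ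
    Function.injective_id.injOn (C := D * |r|) (by positivity) (fun n hn => absurd trivial hn)
    (fun n _ => by
      rw [← Real.norm_eq_abs r, ← Complex.norm_real r]
      exact bound _ _ _ _ fun h => hd _ ((Finsupp.le_degree x n).trans h))
  refine ⟨χ₁ + χ₂ + χ₃, fun n => ?_, ?_⟩
  · rw [lp.coeFn_add, lp.coeFn_add, Pi.add_apply, Pi.add_apply, h₁, h₂, h₃, siteLadder]
  · calc _ ≤ ‖χ₁‖ + ‖χ₂‖ + ‖χ₃‖ := norm_add₃_le
      _ ≤ _ := by linarith

/-- The one-site vectors are summed over x in norm, which is where the ℓ¹ condition enters.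
Describing χ by convergent coordinate sums lets uniqueness of sums identify it with spin or boson
vectors defined elsewhere. -/
theorem exists_ladder {K : ℕ} (ψ : Fock L) (hψ : ∀ n : L →₀ ℕ, K < n.degree → ψ n = 0)
    {z : L → ℂ} {r : L → ℝ} {B : ℝ} (hz : Summable fun x => ‖z x‖) (hr : Summable fun x => |r x|)
    (hzB : ∑' x, ‖z x‖ ≤ B) (hrB : ∑' x, |r x| ≤ B) {c d : ℕ → ℝ} {C D : ℝ}
    (hc : ∀ a ≤ K, |c a| ≤ C) (hd : ∀ a ≤ K, |d a| ≤ D) :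
    ∃ χ : Fock L, (∀ n, HasSum (fun x => siteLadder x (z x) (r x) c d ψ n) (χ n)) ∧
      (∀ n : L →₀ ℕ, K + 1 < n.degree → χ n = 0) ∧ ‖χ‖ ≤ (2 * C + D) * B * ‖ψ‖ := by
  have hC : 0 ≤ C := (abs_nonneg _).trans (hc 0 (Nat.zero_le K))
  have hD : 0 ≤ D := (abs_nonneg _).trans (hd 0 (Nat.zero_le K))
  choose χ h1 h2 using fun x => exists_siteLadder ψ hψ x (z x) (r x) hc hd
  have hs : Summable fun x => (2 * C * ‖z x‖ + D * |r x|) * ‖ψ‖ :=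
    ((hz.mul_left _).add (hr.mul_left _)).mul_right _
  have hχ : Summable χ := Summable.of_norm_bounded hs h2
  have hsum : ∀ n, HasSum (fun x => siteLadder x (z x) (r x) c d ψ n) ((∑' x, χ x : Fock L) n) :=
    fun n => by
      have : HasSum (fun x => χ x n) ((∑' x, χ x : Fock L) n) :=
        hχ.hasSum.mapL (lp.evalCLM ℂ (fun _ : L →₀ ℕ => ℂ) 2 n)
      simpa only [h1] using this
  refine ⟨∑' x, χ x, hsum, fun n hn => ?_, ?_⟩
  · refine (hsum n).unique ?_
    simpa only [siteLadder_eq_zero hψ _ _ _ c d hn] using hasSum_zero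
  · calc _ ≤ ∑' x, (2 * C * ‖z x‖ + D * |r x|) * ‖ψ‖ := tsum_of_norm_bounded hs.hasSum h2
      _ = (2 * C * ∑' x, ‖z x‖ + D * ∑' x, |r x|) * ‖ψ‖ := by
          rw [tsum_mul_right, (hz.mul_left _).tsum_add (hr.mul_left _), tsum_mul_left,
            tsum_mul_left]
      _ ≤ (2 * C * B + D * B) * ‖ψ‖ := by gcongr
      _ = _ := by ring

/-- Since d = 0 the family r is free; it is later taken to be the radial coordinate, so that spin
and boson sums match term by term. -/
theorem hasSum_bosonField (w : lp (fun _ : L => ℂ) 2) (r : L → ℝ) (ψ : finiteParticle L)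
    (n : L →₀ ℕ) :
    HasSum (fun x => siteLadder x (w x) (r x) (fun a => √((a : ℝ) + 1)) (fun _ => 0) (ψ : Fock L) n)
      ((bosonField w ψ : Fock L) n) := by
  have h1 : HasSum (fun x => if n x = 0 then 0 else
      w x * ((√(((n x - 1 : ℕ) : ℝ) + 1) : ℝ) : ℂ) * (ψ : Fock L) (n - Finsupp.single x 1))
      (creationFun w (ψ : Fock L) n) := by
    have : creationFun w (ψ : Fock L) n = ∑ x ∈ n.support, if n x = 0 then 0 else
        w x * ((√(((n x - 1 : ℕ) : ℝ) + 1) : ℝ) : ℂ) *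
          (ψ : Fock L) (n - Finsupp.single x 1) := by
      refine Finset.sum_congr rfl fun x hx => ?_
      have hx := Finsupp.mem_support_iff.1 hx
      rw [if_neg hx]
      congr 5
      exact_mod_cast (Nat.succ_pred_eq_of_ne_zero hx).symm
    rw [this]
    exact hasSum_sum_of_ne_finset_zero fun x hx => if_pos (Finsupp.notMem_support_iff.1 hx)
  have h2 := (summable_annihilation w ψ.1 n).hasSum
  have h3 := h1.add h2
  have hfun : (fun x => siteLadder x (w x) (r x) (fun a => √((a : ℝ) + 1)) (fun _ => 0)
      (ψ : Fock L) n) = fun x => (if n x = 0 then 0 else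
        w x * ((√(((n x - 1 : ℕ) : ℝ) + 1) : ℝ) : ℂ) * (ψ : Fock L) (n - Finsupp.single x 1)) +
      (starRingEnd ℂ) (w x) * (√((n x : ℝ) + 1) : ℂ) * (ψ : Fock L) (n + Finsupp.single x 1) := by
    funext x
    rw [siteLadder, Complex.ofReal_zero, mul_zero, zero_mul, add_zero]
  rw [hfun]
  exact h3

end Ladder

/-! ### Holstein–Primakoff coordinates -/

section HolsteinPrimakoff

variable {L : Type*}

/-- The matrix elements `√(n + 1) √(1 - n / (2J))` of the lowering operator, `N = 2J`. -/
def hpCoeff (N a : ℕ) : ℝ := √((a : ℝ) + 1) * √(1 - (a : ℝ) / N)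

/-- The matrix elements of the axial component of the fluctuation operator. -/
def hpAxis (N a : ℕ) : ℝ := -(2 * min (a : ℝ) N / √N)

/-- The spin configuration with occupation numbers `n`. -/
def toConfig (N : ℕ) (n : L →₀ ℕ) : L → Fin (N + 1) := fun x => Fin.ofNat (N + 1) (n x)

theorem val_toConfig {N : ℕ} {n : L →₀ ℕ} {x : L} (h : n x ≤ N) : (toConfig N n x : ℕ) = n x := by
  rw [toConfig, Fin.val_ofNat]
  exact Nat.mod_eq_of_lt (by omega)

open Classical in
/-- Coordinates in occupation numbers of a vector in the configuration space. -/
def toFock (N : ℕ) (χ : (L → Fin (N + 1)) → ℂ) (n : L →₀ ℕ) : ℂ :=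
  if ∀ x, n x ≤ N then χ (toConfig N n) else 0

theorem toFock_of_lt {N : ℕ} (χ : (L → Fin (N + 1)) → ℂ) {n : L →₀ ℕ} {x : L} (h : N < n x) :
    toFock N χ n = 0 :=
  if_neg fun h' => absurd (h' x) (by omega)

theorem sqrt_two_div_half (N : ℕ) : √(2 / ((N : ℝ) / 2)) = 2 / √N := by
  rw [div_div_eq_mul_div, Real.sqrt_div (by norm_num)]
  congr 1
  rw [show (2 : ℝ) * 2 = 2 ^ 2 by norm_num, Real.sqrt_sq (by norm_num)]

/-- The prefactor √(2/J) = 2/√N, times the 1/2 with which S^± enters w · S, gives √((a + 1)(N -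
a)/N). -/
theorem two_div_sqrt_mul_ladderCoeff {N a : ℕ} (hN : 0 < N) (ha : a ≤ N) :
    2 / √(N : ℝ) * (ladderCoeff N a / 2) = hpCoeff N a := by
  have h : (0 : ℝ) < N := by exact_mod_cast hN
  have h1 : 1 - (a : ℝ) / N = ((N : ℝ) - a) / N := by field_simp
  have h2 : (a : ℝ) ≤ N := by exact_mod_cast ha
  rw [ladderCoeff, hpCoeff, h1, Real.sqrt_div (by linarith), Real.sqrt_mul (by positivity)]
  field_simp

theorem hpCoeff_self {N : ℕ} (hN : 0 < N) : hpCoeff N N = 0 := by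
  have h : (N : ℝ) ≠ 0 := by exact_mod_cast hN.ne'
  simp [hpCoeff, div_self h]

/-- Occupation numbers at most N are preserved: the only way out is a step from N to N + 1, whose
coefficient is 0. -/
theorem siteLadder_toFock_of_lt {N : ℕ} (hN : 0 < N) (x : L) (z : ℂ) (r : ℝ) (d : ℕ → ℝ)
    (χ : (L → Fin (N + 1)) → ℂ) {n : L →₀ ℕ} {y : L} (hy : N < n y) :
    siteLadder x z r (hpCoeff N) d (toFock N χ) n = 0 := by
  classical
  have h1 : toFock N χ (n + Finsupp.single x 1) = 0 :=
    toFock_of_lt χ (x := y) (by rw [Finsupp.add_apply]; omega)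
  rw [siteLadder, h1, toFock_of_lt χ hy]
  split_ifs with h
  · simp
  · by_cases hxy : x = y ∧ n y = N + 1
    · rw [hxy.1, hxy.2, Nat.add_sub_cancel, hpCoeff_self hN]
      simp
    · rw [toFock_of_lt χ (x := y)]
      · simp
      · rw [Finsupp.tsub_apply, Finsupp.single_apply]
        split_ifs with hx
        · have : n y ≠ N + 1 := fun h' => hxy ⟨hx, h'⟩
          omega
        · omega

variable [DecidableEq L]

theorem siteOp_centeredComponent_apply {N : ℕ} (x : L) (z : ℂ) (r : ℝ) (χ : ConfigSpace L N)
    (σ : L → Fin (N + 1)) :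
    siteOp x (centeredComponent N z r) χ σ =
      z / 2 * (spinLower N *ᵥ fun m => χ (Function.update σ x m)) (σ x) +
        (starRingEnd ℂ) z / 2 * (spinRaise N *ᵥ fun m => χ (Function.update σ x m)) (σ x) -
        r * (σ x : ℕ) * χ σ := by
  have : siteOp x (centeredComponent N z r) χ σ =
      (centeredComponent N z r *ᵥ fun m => χ (Function.update σ x m)) (σ x) := rfl
  rw [this, centeredComponent, spinComponent]
  simp only [Matrix.sub_mulVec, Matrix.add_mulVec, Matrix.smul_mulVec, Pi.sub_apply, Pi.add_apply,
    Pi.smul_apply, smul_eq_mul, spinAxis_mulVec, Matrix.one_mulVec, Function.update_eq_self]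
  push_cast
  ring

theorem siteLadder_toFock {N : ℕ} (hN : 0 < N) (x : L) (z : ℂ) (r : ℝ) (χ : ConfigSpace L N)
    {n : L →₀ ℕ} (hn : ∀ y, n y ≤ N) :
    ((√(2 / ((N : ℝ) / 2)) : ℝ) : ℂ) * siteOp x (centeredComponent N z r) χ (toConfig N n) =
      siteLadder x z r (hpCoeff N) (hpAxis N) (toFock N χ) n := by
  have hx := val_toConfig (hn x)
  have hr : (r : ℂ) * hpAxis N (n x) * toFock N χ n =
      -(((2 / √(N : ℝ) : ℝ) : ℂ) * (r * (n x : ℕ) * χ (toConfig N n))) := by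
    rw [hpAxis, min_eq_left (by exact_mod_cast hn x), toFock, if_pos hn]
    push_cast
    ring
  have hdown : ((2 / √(N : ℝ) : ℝ) : ℂ) * ((starRingEnd ℂ) z / 2 *
      (spinRaise N *ᵥ fun m => χ (Function.update (toConfig N n) x m)) (toConfig N n x)) =
      (starRingEnd ℂ) z * hpCoeff N (n x) * toFock N χ (n + Finsupp.single x 1) := by
    rw [← two_div_sqrt_mul_ladderCoeff hN (hn x), spinRaise_mulVec, hx]
    simp only
    split_ifs with h
    · have h1 : ∀ y, (n + Finsupp.single x 1 : L →₀ ℕ) y ≤ N := fun y => by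
        have := hn y
        rw [Finsupp.add_apply, Finsupp.single_apply]
        split_ifs with hxy
        · subst hxy; omega
        · omega
      have h2 : Function.update (toConfig N n) x ⟨n x + 1, h⟩ =
          toConfig N (n + Finsupp.single x 1) := by
        funext y
        refine Fin.ext ?_
        rw [val_toConfig (h1 y)]
        by_cases hxy : y = x
        · subst hxy; simp
        · rw [Function.update_of_ne hxy, val_toConfig (hn y)]
          simp [Ne.symm hxy]
      rw [toFock, if_pos h1, h2]
      push_cast
      ring
    · rw [show n x = N by have := hn x; omega, ladderCoeff_self]
      simp
  have hup : ((2 / √(N : ℝ) : ℝ) : ℂ) * (z / 2 *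
      (spinLower N *ᵥ fun m => χ (Function.update (toConfig N n) x m)) (toConfig N n x)) =
      if n x = 0 then 0 else z * hpCoeff N (n x - 1) * toFock N χ (n - Finsupp.single x 1) := by
    rw [spinLower_mulVec]
    simp only [hx]
    split_ifs with h
    · simp
    · have h1 : ∀ y, (n - Finsupp.single x 1 : L →₀ ℕ) y ≤ N := fun y => by
        have := hn y
        rw [Finsupp.tsub_apply]
        omega
      have h2 : Function.update (toConfig N n) x ⟨n x - 1, by have := hn x; omega⟩ =
          toConfig N (n - Finsupp.single x 1) := by
        funext y
        refine Fin.ext ?_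
        rw [val_toConfig (h1 y)]
        by_cases hxy : y = x
        · subst hxy; simp
        · rw [Function.update_of_ne hxy, val_toConfig (hn y)]
          simp [Ne.symm hxy]
      rw [← two_div_sqrt_mul_ladderCoeff hN (show n x - 1 ≤ N by have := hn x; omega), toFock,
        if_pos h1, h2]
      push_cast
      ring
  rw [sqrt_two_div_half, siteOp_centeredComponent_apply, siteLadder, hr, ← hdown, ← hup, hx]
  ring

/-- `toFock` forgets configurations with infinitely many excited sites. This is harmless, because a
coordinate at a finitely supported n depends only on coordinates of the same kind. -/
theorem hasSum_framedFluctuation {N : ℕ} (hN : 0 < N) {z : L → ℂ} {r : L → ℝ}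
    (hz : Summable fun x => ‖z x‖) (hr : Summable fun x => |r x|) (χ : ConfigSpace L N)
    (n : L →₀ ℕ) :
    HasSum (fun x => siteLadder x (z x) (r x) (hpCoeff N) (hpAxis N) (toFock N χ) n)
      (toFock N (framedFluctuation N z r χ) n) := by
  by_cases hn : ∀ y, n y ≤ N
  · simp only [← siteLadder_toFock hN _ _ _ χ hn]
    rw [toFock, if_pos hn]
    have h1 := (summable_framedFluctuation N hz hr).hasSum.mapL
      ((ContinuousLinearMap.apply ℂ (ConfigSpace L N)) χ)
    have h2 := (h1.mapL (lp.evalCLM ℂ (fun _ : L → Fin (N + 1) => ℂ) 2 (toConfig N n))).mul_left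
      ((√(2 / ((N : ℝ) / 2)) : ℝ) : ℂ)
    exact h2
  · push Not at hn
    obtain ⟨y, hy⟩ := hn
    simp only [siteLadder_toFock_of_lt hN _ _ _ _ _ hy]
    rw [toFock_of_lt _ hy]
    exact hasSum_zero

end HolsteinPrimakoff

section Comparison

/-! ### Estimates for the matrix elements -/

/-- For t ≤ 1 the numbers √t and √(1 - t) have squares summing to 1, hence sum at least 1; for t > 1
the inner root is 0 by convention. With t = a/N the rate is N^{-1/2}, the same as for the axial
part. -/
theorem one_sub_sqrt_one_sub_le {t : ℝ} (ht : 0 ≤ t) : |1 - √(1 - t)| ≤ √t := by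
  have h1 : √(1 - t) ≤ 1 := Real.sqrt_le_one.2 (by linarith)
  rw [abs_of_nonneg (by linarith)]
  have h2 := Real.sqrt_nonneg t
  have h3 := Real.sqrt_nonneg (1 - t)
  by_cases h : t ≤ 1
  · have h4 := Real.sq_sqrt ht
    have h5 := Real.sq_sqrt (sub_nonneg.2 h)
    nlinarith [mul_nonneg h2 h3]
  · have : 1 ≤ √t := Real.one_le_sqrt.2 (by linarith)
    linarith

theorem abs_hpCoeff_le {N K a : ℕ} (ha : a ≤ K) : |hpCoeff N a| ≤ √((K : ℝ) + 1) := by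
  have h : (a : ℝ) ≤ K := by exact_mod_cast ha
  rw [hpCoeff, abs_of_nonneg (by positivity), ← mul_one √((K : ℝ) + 1)]
  gcongr
  exact Real.sqrt_le_one.2 (by linarith [show 0 ≤ (a : ℝ) / N by positivity])

/-- The truncation at N in `hpAxis` is what makes this hold for every a. It bounds the axial
coefficients independently of N, and changes nothing on the occupation numbers that spins can have.
-/
theorem min_div_sqrt_le {N : ℕ} (hN : 0 < N) (a : ℕ) : min (a : ℝ) N / √N ≤ √a := by
  have h : (0 : ℝ) < √N := Real.sqrt_pos.2 (by exact_mod_cast hN)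
  rw [div_le_iff₀ h, ← Real.sqrt_mul (by positivity)]
  refine Real.le_sqrt_of_sq_le ?_
  rw [sq]
  gcongr
  · exact min_le_left _ _
  · exact min_le_right _ _

theorem abs_hpAxis (N a : ℕ) : |hpAxis N a| = 2 * (min (a : ℝ) N / √N) := by
  rw [hpAxis, abs_neg, abs_of_nonneg (by positivity), mul_div_assoc]

theorem abs_hpAxis_le {N K a : ℕ} (hN : 0 < N) (ha : a ≤ K) :
    |hpAxis N a| ≤ 2 * √((K : ℝ) + 1) := by
  have h : (a : ℝ) ≤ K := by exact_mod_cast ha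
  rw [abs_hpAxis]
  refine mul_le_mul_of_nonneg_left ((min_div_sqrt_le hN a).trans ?_) (by norm_num)
  exact Real.sqrt_le_sqrt (by linarith)

theorem abs_hpCoeff_sub_le {N K a : ℕ} (ha : a ≤ K) :
    |hpCoeff N a - √((a : ℝ) + 1)| ≤ √((K : ℝ) + 1) * (√(K : ℝ) / √(N : ℝ)) := by
  have h : (a : ℝ) ≤ K := by exact_mod_cast ha
  have h1 : hpCoeff N a - √((a : ℝ) + 1) = -(√((a : ℝ) + 1) * (1 - √(1 - (a : ℝ) / N))) := by
    rw [hpCoeff]; ring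
  rw [h1, abs_neg, abs_mul, abs_of_nonneg (Real.sqrt_nonneg _), ← Real.sqrt_div (by positivity)]
  gcongr
  exact (one_sub_sqrt_one_sub_le (by positivity)).trans (by gcongr)

/-- K is weakened to √(K + 1) √K so that the bound is twice the one in `abs_hpCoeff_sub_le`; then 2C
+ D is 4√(K + 1) √K/√N, the shape that the recursion needs. -/
theorem abs_hpAxis_le_div {N K a : ℕ} (ha : a ≤ K) :
    |hpAxis N a| ≤ 2 * (√((K : ℝ) + 1) * (√(K : ℝ) / √(N : ℝ))) := by
  have h : (a : ℝ) ≤ K := by exact_mod_cast ha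
  rw [abs_hpAxis, ← mul_div_assoc √((K : ℝ) + 1)]
  gcongr
  calc min (a : ℝ) N ≤ K := (min_le_left _ _).trans h
    _ = √(K : ℝ) * √(K : ℝ) := (Real.mul_self_sqrt (by positivity)).symm
    _ ≤ √((K : ℝ) + 1) * √(K : ℝ) := by gcongr; linarith

/-! ### The comparison -/

variable {L : Type*}

theorem vacuum_apply_zero : (vacuum L : Fock L) 0 = 1 := by
  classical exact lp.single_apply_self _ _ _

theorem vacuum_apply_of_ne {n : L →₀ ℕ} (hn : n ≠ 0) : (vacuum L : Fock L) n = 0 :=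
  by classical exact lp.single_apply_ne _ _ _ hn

theorem inner_vacuum (ξ : Fock L) : ⟪(vacuum L : Fock L), ξ⟫_ℂ = ξ 0 := by
  classical
  rw [vacuum, lp.inner_single_left]
  simp

theorem toConfig_zero (N : ℕ) : toConfig N (0 : L →₀ ℕ) = 0 :=
  funext fun x => Fin.ext (by simp [toConfig])

theorem tsum_norm_tangentCoord_le (θ φ : L → ℝ) (v : SummableField L) :
    ∑' x, ‖tangentCoord (θ x) (φ x) (v x)‖ ≤ ‖v‖ := by
  have hv : Summable fun x => ‖v x‖ := by simpa using (lp.memℓp v).summable (by simp)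
  have hn : ‖v‖ = ∑' x, ‖v x‖ := by simpa using lp.norm_eq_tsum_rpow (p := 1) (by simp) v
  rw [hn]
  exact (summable_norm_tangentCoord θ φ v).tsum_le_tsum
    (fun x => norm_tangentCoord_le_norm (θ x) (φ x) (v x)) hv

theorem tsum_abs_radialCoord_le (θ φ : L → ℝ) (v : SummableField L) :
    ∑' x, |radialCoord (θ x) (φ x) (v x)| ≤ ‖v‖ := by
  have hv : Summable fun x => ‖v x‖ := by simpa using (lp.memℓp v).summable (by simp)
  have hn : ‖v‖ = ∑' x, ‖v x‖ := by simpa using lp.norm_eq_tsum_rpow (p := 1) (by simp) v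
  rw [hn]
  exact (summable_abs_radialCoord θ φ v).tsum_le_tsum
    (fun x => abs_radialCoord_le_norm (θ x) (φ x) (v x)) hv

/-- `exists_ladder` with coefficients built from an element of `ℓ¹₃`. -/
theorem exists_ladder_field {K : ℕ} (ψ : Fock L) (hψ : ∀ n : L →₀ ℕ, K < n.degree → ψ n = 0)
    (θ φ : L → ℝ) (v : SummableField L) {c d : ℕ → ℝ} {C D : ℝ}
    (hc : ∀ a ≤ K, |c a| ≤ C) (hd : ∀ a ≤ K, |d a| ≤ D) :
    ∃ χ : Fock L, (∀ n, HasSum (fun x => siteLadder x (tangentCoord (θ x) (φ x) (v x))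
        (radialCoord (θ x) (φ x) (v x)) c d ψ n) (χ n)) ∧
      (∀ n : L →₀ ℕ, K + 1 < n.degree → χ n = 0) ∧ ‖χ‖ ≤ (2 * C + D) * ‖v‖ * ‖ψ‖ :=
  exists_ladder ψ hψ (summable_norm_tangentCoord θ φ v) (summable_abs_radialCoord θ φ v)
    (tsum_norm_tangentCoord_le θ φ v) (tsum_abs_radialCoord_le θ φ v) hc hd

/-! ### Growth of boson field products on the vacuum -/

theorem norm_bosonField_le (θ φ : L → ℝ) (v : SummableField L) {K : ℕ} (ψ : finiteParticle L)
    (hψ : ∀ n : L →₀ ℕ, K < n.degree → (ψ : Fock L) n = 0) :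
    (∀ n : L →₀ ℕ, K + 1 < n.degree → (bosonField (tangentField θ φ v) ψ : Fock L) n = 0) ∧
      ‖(bosonField (tangentField θ φ v) ψ : Fock L)‖ ≤
        2 * √((K : ℝ) + 1) * ‖v‖ * ‖(ψ : Fock L)‖ := by
  obtain ⟨χ, h1, h2, h3⟩ := exists_ladder_field (ψ : Fock L) hψ θ φ v
    (c := fun a => √((a : ℝ) + 1)) (d := fun _ => 0) (C := √((K : ℝ) + 1)) (D := 0)
    (fun a ha => by
      have h : (a : ℝ) ≤ K := by exact_mod_cast ha
      rw [abs_of_nonneg (by positivity)]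
      gcongr) (fun _ _ => by simp)
  have : (bosonField (tangentField θ φ v) ψ : Fock L) = χ :=
    lp.ext (funext fun n => (hasSum_bosonField (tangentField θ φ v) _ ψ n).unique (h1 n))
  rw [this]
  exact ⟨h2, by simpa using h3⟩

theorem norm_bosonField_prod_le (θ φ : L → ℝ) (vs : List (SummableField L)) :
    (∀ n : L →₀ ℕ, vs.length < n.degree →
      ((vs.map fun v => bosonField (tangentField θ φ v)).prod (vacuum L) : Fock L) n = 0) ∧
    ‖((vs.map fun v => bosonField (tangentField θ φ v)).prod (vacuum L) : Fock L)‖ ≤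
      2 ^ vs.length * √(vs.length.factorial : ℝ) * (vs.map fun v => ‖v‖).prod := by
  classical
  induction vs with
  | nil =>
    refine ⟨fun n hn => vacuum_apply_of_ne ?_, ?_⟩
    · rintro rfl
      simp at hn
    · simp [vacuum, lp.norm_single (E := fun _ : L →₀ ℕ => ℂ) (p := 2) (by norm_num)]
  | cons v vs ih =>
    obtain ⟨h1, h2⟩ := norm_bosonField_le θ φ v _ ih.1
    rw [List.map_cons, List.prod_cons, Module.End.mul_apply, List.length_cons]
    refine ⟨h1, h2.trans ?_⟩
    calc _ ≤ 2 * √((vs.length : ℝ) + 1) * ‖v‖ *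
          (2 ^ vs.length * √(vs.length.factorial : ℝ) * (vs.map fun v => ‖v‖).prod) := by
          gcongr
          exact ih.2
      _ = _ := by
          rw [Nat.factorial_succ, Nat.cast_mul, Real.sqrt_mul (by positivity), List.map_cons,
            List.prod_cons]
          push_cast
          ring

/-- Recursion in `k` for the sum in the error bound for `k` fluctuation operators. -/
theorem errorSum_succ (k : ℕ) :
    ∑ i ∈ Finset.Icc 1 (k + 1), (2 : ℝ) ^ (k + 1 + i) * √(((k + 1 : ℕ) : ℝ) - i) =
      4 * 2 ^ k * √k + 4 * ∑ i ∈ Finset.Icc 1 k, (2 : ℝ) ^ (k + i) * √((k : ℝ) - i) := by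
  have h : ∀ (m : ℕ) (f : ℕ → ℝ), ∑ i ∈ Finset.Icc 1 m, f i = ∑ i ∈ Finset.range m, f (i + 1) :=
    fun m f => by
      rw [Finset.range_eq_Ico, Finset.sum_Ico_add' f 0 m 1]
      rfl
  rw [h, h, Finset.sum_range_succ', Finset.mul_sum, add_comm]
  congr 1
  · push_cast
    rw [add_sub_cancel_right]
    ring
  · refine Finset.sum_congr rfl fun i _ => ?_
    push_cast
    rw [add_sub_add_right_eq_sub]
    ring

/-! ### Induction on the number of factors -/

variable [DecidableEq L]

theorem exists_framedFluctuation_approx {N : ℕ} (hN : 0 < N) (θ φ : L → ℝ)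
    (vs : List (SummableField L)) :
    ∃ ψ : Fock L, (∀ n, ψ n = toFock N ((vs.map fun v => framedFluctuation N
        (fun x => tangentCoord (θ x) (φ x) (v x))
        (fun x => radialCoord (θ x) (φ x) (v x))).prod (productVector N θ φ ∅)) n) ∧
      (∀ n : L →₀ ℕ, vs.length < n.degree → ψ n = 0) ∧
      ‖ψ - ((vs.map fun v => bosonField (tangentField θ φ v)).prod (vacuum L) : Fock L)‖ ≤
        √(vs.length.factorial : ℝ) / √(N : ℝ) * (vs.map fun v => ‖v‖).prod *
          ∑ i ∈ Finset.Icc 1 vs.length, (2 : ℝ) ^ (vs.length + i) * √((vs.length : ℝ) - i) := by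
  classical
  induction vs with
  | nil =>
    refine ⟨(vacuum L : Fock L), fun n => ?_, (norm_bosonField_prod_le θ φ []).1, by simp⟩
    rw [List.map_nil, List.prod_nil, one_apply_eq_self, toFock]
    by_cases hn : n = 0
    · subst hn
      rw [vacuum_apply_zero, toConfig_zero, if_pos (by simp)]
      simp [productVector_apply]
    · rw [vacuum_apply_of_ne hn]
      split_ifs with h
      · rw [productVector_apply, if_neg]
        intro h'
        refine hn (Finsupp.ext fun y => ?_)
        have := congrArg Fin.val (h' y (Finset.notMem_empty y))
        rwa [val_toConfig (h y)] at this
      · rfl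
  | cons v vs ih =>
    obtain ⟨ψ, hψ, hdeg, hle⟩ := ih
    obtain ⟨hdegF, hleF⟩ := norm_bosonField_prod_le θ φ vs
    set χ : ConfigSpace L N := (vs.map fun v => framedFluctuation N
        (fun x => tangentCoord (θ x) (φ x) (v x))
        (fun x => radialCoord (θ x) (φ x) (v x))).prod (productVector N θ φ ∅) with hχ
    set ξ : finiteParticle L :=
      (vs.map fun v => bosonField (tangentField θ φ v)).prod (vacuum L) with hξ
    have hdegD : ∀ n : L →₀ ℕ, vs.length < n.degree → (ψ - (ξ : Fock L)) n = 0 := fun n hn => by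
      rw [lp.coeFn_sub, Pi.sub_apply, hdeg n hn, hdegF n hn, sub_zero]
    set k := vs.length with hk
    -- With T the spin ladder operator and F the boson field, α is T(ψ - ξ) and β below is (T - F)ξ.
    -- The new vector is α + β + Fξ, so its distance to Fξ is ‖α + β‖.
    obtain ⟨α, hα, hα', hαn⟩ := exists_ladder_field _ hdegD θ φ v
      (fun a ha => abs_hpCoeff_le (N := N) ha) (fun a ha => abs_hpAxis_le hN ha)
    obtain ⟨β, hβ, hβ', hβn⟩ := exists_ladder_field _ hdegF θ φ v
      (c := fun a => hpCoeff N a - √((a : ℝ) + 1))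
      (fun a ha => abs_hpCoeff_sub_le (N := N) ha) (fun a ha => abs_hpAxis_le_div (N := N) ha)
    have hγ := hasSum_bosonField (tangentField θ φ v)
      (fun x => radialCoord (θ x) (φ x) (v x)) ξ
    obtain ⟨hγ', -⟩ := norm_bosonField_le θ φ v ξ hdegF
    have hdiff : α + β + (bosonField (tangentField θ φ v) ξ : Fock L) -
        (bosonField (tangentField θ φ v) ξ : Fock L) = α + β := add_sub_cancel_right _ _
    simp only [List.map_cons, List.prod_cons, List.length_cons, Module.End.mul_apply,
      mul_apply_eq_comp, ← hχ, ← hξ, ← hk]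
    refine ⟨α + β + (bosonField (tangentField θ φ v) ξ : Fock L), fun n => ?_, fun n hn => ?_, ?_⟩
    · have h1 := hasSum_framedFluctuation hN (summable_norm_tangentCoord θ φ v)
        (summable_abs_radialCoord θ φ v) χ n
      refine HasSum.unique ?_ h1
      have h2 := ((hα n).add (hβ n)).add (hγ n)
      have hψ' : toFock N χ = ψ := (funext hψ).symm
      have hw : ∀ x, (tangentField θ φ v : L → ℂ) x = tangentCoord (θ x) (φ x) (v x) :=
        fun _ => rfl
      rw [hψ', lp.coeFn_add, lp.coeFn_add, Pi.add_apply, Pi.add_apply]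
      convert h2 using 2 with x
      -- Site by site, T(ψ - ξ) + (T - F)ξ + Fξ = Tψ, by linearity of `siteLadder` in the vector and
      -- in its coefficients.
      simp only [siteLadder, hw, lp.coeFn_sub, Pi.sub_apply]
      push_cast
      split_ifs <;> ring
    · rw [lp.coeFn_add, lp.coeFn_add, Pi.add_apply, Pi.add_apply, hα' n hn, hβ' n hn, hγ' n hn]
      simp
    · rw [hdiff, errorSum_succ, Nat.factorial_succ, Nat.cast_mul, Real.sqrt_mul (by positivity)]
      set P := (vs.map fun v => ‖v‖).prod
      set E := ∑ i ∈ Finset.Icc 1 k, (2 : ℝ) ^ (k + i) * √((k : ℝ) - i)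
      calc _ ≤ ‖α‖ + ‖β‖ := norm_add_le _ _
        _ ≤ (2 * √((k : ℝ) + 1) + 2 * √((k : ℝ) + 1)) * ‖v‖ *
              (√(k.factorial : ℝ) / √(N : ℝ) * P * E) +
            (2 * (√((k : ℝ) + 1) * (√(k : ℝ) / √(N : ℝ))) +
              2 * (√((k : ℝ) + 1) * (√(k : ℝ) / √(N : ℝ)))) * ‖v‖ *
                (2 ^ k * √(k.factorial : ℝ) * P) := by
            gcongr
            · exact hαn.trans (by gcongr)
            · exact hβn.trans (by gcongr)
        _ = _ := by
            push_cast
            ring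

end Comparison

end SpinFluctuations

end

/-! ### Error bound and limit for the expectations -/

theorem mainTheorem7 {L : Type*} [DecidableEq L] (θ φ : L → ℝ)
    (hθ : ∀ x, θ x ∈ Set.Icc 0 Real.pi) (hφ : ∀ x, φ x ∈ Set.Icc 0 (2 * Real.pi))
    (k : ℕ) (v : Fin k → SummableField L) :
    Tendsto
      (fun N : ℕ => coherentState N θ φ (List.ofFn fun j => fluctuation N θ φ (v j)).prod)
      atTop
      (𝓝 (fockState (List.ofFn fun j => bosonField (tangentField θ φ (v j))).prod)) ∧
    ∀ N : ℕ, 0 < N →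
      ‖coherentState N θ φ (List.ofFn fun j => fluctuation N θ φ (v j)).prod -
          fockState (List.ofFn fun j => bosonField (tangentField θ φ (v j))).prod‖ ≤
        √(k.factorial : ℝ) / √(N : ℝ) * (∏ j, ‖v j‖) *
          ∑ i ∈ Finset.Icc 1 k, (2 : ℝ) ^ (k + i) * √((k : ℝ) - i) := by
  classical
  have hbound : ∀ N : ℕ, 0 < N →
      ‖coherentState N θ φ (List.ofFn fun j => fluctuation N θ φ (v j)).prod -
          fockState (List.ofFn fun j => bosonField (tangentField θ φ (v j))).prod‖ ≤
        √(k.factorial : ℝ) / √(N : ℝ) * (∏ j, ‖v j‖) *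
          ∑ i ∈ Finset.Icc 1 k, (2 : ℝ) ^ (k + i) * √((k : ℝ) - i) := by
    intro N hN
    obtain ⟨ψ, hψ, -, hle⟩ := exists_framedFluctuation_approx hN θ φ (List.ofFn v)
    have h1 : (List.ofFn fun j => fluctuation N θ φ (v j)) =
        (List.ofFn v).map fun v => fluctuation N θ φ v := by
      rw [List.map_ofFn]; rfl
    have h2 : (List.ofFn fun j => bosonField (tangentField θ φ (v j))) =
        (List.ofFn v).map fun v => bosonField (tangentField θ φ v) := by
      rw [List.map_ofFn]; rfl
    have h3 : ((List.ofFn v).map fun v => ‖v‖).prod = ∏ j, ‖v j‖ := by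
      rw [List.map_ofFn, List.prod_ofFn]; rfl
    rw [List.length_ofFn, h3] at hle
    -- Both expectations are coordinates at occupation number 0, and a single coordinate of an ℓ²
    -- vector is bounded by its norm.
    have h5 := hψ 0
    rw [toFock, if_pos (by simp), toConfig_zero, ← coherentState_prod_fluctuation] at h5
    rw [h1, h2, ← h5, fockState, inner_vacuum]
    exact (lp.norm_apply_le_norm (by norm_num) (ψ - _) 0).trans hle
  refine ⟨?_, hbound⟩
  rw [tendsto_iff_norm_sub_tendsto_zero]
  refine squeeze_zero' (Eventually.of_forall fun N => norm_nonneg _)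
    ((eventually_gt_atTop 0).mono hbound) ?_
  have h : Tendsto (fun N : ℕ => √(N : ℝ)) atTop atTop :=
    Real.tendsto_sqrt_atTop.comp tendsto_natCast_atTop_atTop
  have h' := ((h.const_div_atTop √(k.factorial : ℝ)).mul_const (∏ j, ‖v j‖)).mul_const
    (∑ i ∈ Finset.Icc 1 k, (2 : ℝ) ^ (k + i) * √((k : ℝ) - i))
  simpa using h'
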